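/- **Setting and notation.** Let $\nu\in\mathbb N$, $\omega_1,\dots,\omega_\nu>0$, $T>0$, $\varepsilon>0$, and let $\mu$ be a $\mathbb C$-valued Borel measure on $\mathbb R^\nu$ with total variation $|\mu|$. Write $|\cdot|$ for the Euclidean norm, $a\cdot b=\sum_\upsilon a_\upsilon b_\upsilon$, $\xi^2=\xi\cdot\xi$, and put $$M_{\mu,\varepsilon}:=\int_{\mathbb R^\nu}e^{\varepsilon\xi^2+5|\xi|}\,d|\mu|(\xi),\qquad D:=\{z\in\mathbb C^\nu:\ |\operatorname{Im}z|<\tfrac12\},\qquad S_\kappa:=\{z\in\mathbb C:\ |\operatorname{Im}z^{1/2}|^2<\kappa\}$$ (principal square root). For $0<t<T$, $x,y\in\mathbb C^\nu$, $s\in[0,1]$ let $q_t(s)\in\mathbb C^\nu$ have coordinates $$q_{t,\upsilon}(s)=\frac{\sinh(\omega_\upsilon ts)\,x_\upsilon+\sinh(\omega_\upsilon t(1-s))\,y_\upsilon}{\sinh(\omega_\upsilon t)}.$$ For $m\ge1$ let $\mathcal T_m$ be the set of trees on the vertex set $\{1,\dots,m\}$ (for $m=1$: the single graph without edges). For $g\in\mathcal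 T_m$, $\theta\in[0,1]^g$ (one parameter $\theta_e$ for each edge $e$ of $g$) and $j<k$, let $\theta_{j,k,g}$ be the minimum of $\theta_e$ over the edges $e$ of the path joining $j$ and $k$ in $g$. For $0<s_1<\dots<s_m<1$ and $\xi=(\xi_1,\dots,\xi_m)\in(\mathbb R^\nu)^m$ let $$\Omega_t^{g,\theta}:=\sum_{j=1}^m\sum_{\upsilon=1}^\nu\frac{\sinh(\omega_\upsilon ts_j)\sinh(\omega_\upsilon t(1-s_j))}{\omega_\upsilon\sinh(\omega_\upsilon t)}\xi_{j,\upsilon}^2+2\sum_{1\le j<k\le m}\theta_{j,k,g}\sum_{\upsilon=1}^\nu\frac{\sinh(\omega_\upsilon ts_j)\sinh(\omega_\upsilon t(1-s_k))}{\omega_\upsilon\sinh(\omega_\upsilon t)}\xi_{j,\upsilon}\xi_{k,\upsilon},$$ $$\Upsilon_t^{g}:=\prod_{[j,k]\in g,\ j<k}\ \sum_{\upsilon=1}^\nu\frac{\sinh(\omega_\upsilon ts_j)\sinh(\omega_\upsilon t(1-s_k))}{\omega_\upsilon t\sinh(\omega_\upsilon t)}\xi_{j,\upsilon}\xi_{k,\upsilon}$$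 (an empty product is $1$). For $\operatorname{Re}h>0$ and $m\ge1$ define $$w_m(t,x,y,h):=2^{m-1}(-1)^mt^{2m-1}\sum_{g\in\mathcal T_m}\int_{0<s_1<\dots<s_m<1}\int_{(\mathbb R^\nu)^m}\int_{[0,1]^g\times[0,1]}\Upsilon_t^{g}\,\Omega_t^{g,\theta}\,e^{-h\vartheta\Omega_t^{g,\theta}}\,e^{i\sum_jq_t(s_j)\cdot\xi_j}\,d\vartheta\,d\theta\,d\mu(\xi_1)\cdots d\mu(\xi_m)\,ds,$$ and $w:=\sum_{m\ge1}w_m$. **Proposition.** Assume $4T^2e^TM_{\mu,\varepsilon}<1$. Then there exist $\kappa,K,K_1>0$ and a function $\hat W\in\mathcal C^0\big(]0,T[,\mathcal A(D\times D\times S_\kappa)\big)$ (that is, $\hat W(t,\cdot)$ is analytic on $D\times D\times S_\kappa$ for every $t\in\,]0,T[$ and depends continuously on $t$ for the topology of uniform convergence on compact subsets) such that, for every $(t,x,y)\in\,]0,T[\,\times D\times D$: * for every $\sigma\in S_\kappa$, $\ |\hat W(t,x,y,\sigma)|\le K_1e^{K|\sigma|^{1/2}}$; * for every $h\in\mathbb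 C$ with $\operatorname{Re}h>0$, the series $w(t,x,y,h)=\sum_{m\ge1}w_m(t,x,y,h)$ converges absolutely, the integral below converges absolutely, and $$\exp\big(w(t,x,y,h)\big)=\int_0^{+\infty}e^{-\sigma/h}\,\hat W(t,x,y,\sigma)\,\frac{d\sigma}{h}.$$ -/

import Mathlib

open MeasureTheory

noncomputable section

namespace TreeHeat

/-! ### Domains and function spaces -/

/-- The tube `D_{ℝ^ν, R} = {a + i b | a, b ∈ ℝ^ν, |b| < R}` in `ℂ^ν`, with `|·|` the Euclidean
norm. -/
def tube (ν : ℕ) (R : ℝ) : Set (EuclideanSpace ℂ (Fin ν)) :=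
  {z | ‖(WithLp.toLp 2 (fun υ => (z υ).im) : EuclideanSpace ℝ (Fin ν))‖ < R}

/-- The interior of a parabola `S_κ = {z ∈ ℂ | |Im z^{1/2}|² < κ}`, with the principal square root
(argument of `z` in `(-π, π]`). -/
def parabola (κ : ℝ) : Set ℂ :=
  {z | |(z ^ (1 / 2 : ℂ)).im| ^ 2 < κ}

/-- `F ∈ C⁰(I, 𝒜(Ω))`: every `F t` is analytic on the open set `Ω`, and `t ↦ F t` is continuous
on `I` for the topology of uniform convergence on the compact subsets of `Ω`. -/
def IsContinuousAnalyticFamily {E : Type*} [NormedAddCommGroup E] [NormedSpace ℂ E]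
    (I : Set ℝ) (Ω : Set E) (F : ℝ → E → ℂ) : Prop :=
  (∀ t ∈ I, AnalyticOnNhd ℂ (F t) Ω) ∧
    ∀ t₀ ∈ I, ∀ C : Set E, C ⊆ Ω → IsCompact C →
      TendstoUniformlyOn F (F t₀) (nhdsWithin t₀ I) C

/-! ### Complex measures -/

section Measures

variable {α : Type*} [MeasurableSpace α]

/-- The density `θ` of a complex measure `μ` with respect to its total variation `|μ|`, that is
`dμ = θ d|μ|` (polar decomposition). -/
def polar (μ : ComplexMeasure α) : α → ℂ :=
  μ.rnDeriv μ.variation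

/-- The identity `dμ = θ d|μ|`; a complex measure always has finite total variation. -/
theorem withDensity_polar (μ : ComplexMeasure α) [IsFiniteMeasure μ.variation] :
    μ.variation.withDensityᵥ (polar μ) = μ := by
  have hac : μ ≪ᵥ μ.variation.toENNRealVectorMeasure := μ.absolutelyContinuous
  rw [ComplexMeasure.absolutelyContinuous_ennreal_iff] at hac
  ext1 i hi
  have hint := μ.integrable_rnDeriv μ.variation
  have hre := congrArg (fun v => v i)
    (SignedMeasure.withDensityᵥ_rnDeriv_eq _ μ.variation hac.1)
  have him := congrArg (fun v => v i)
    (SignedMeasure.withDensityᵥ_rnDeriv_eq _ μ.variation hac.2)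
  simp only [withDensityᵥ_apply (SignedMeasure.integrable_rnDeriv _ _) hi] at hre him
  rw [polar, withDensityᵥ_apply hint hi]
  apply Complex.ext
  · rw [← RCLike.re_eq_complex_re, ← integral_re hint.integrableOn]
    exact hre
  · rw [← RCLike.im_eq_complex_im, ← integral_im hint.integrableOn]
    exact him

/-- The integral of `f` over `αᵐ` for the product `μ ⊗ ⋯ ⊗ μ` of `m` copies of the complex measure
`μ`, that is `∫ f(ξ) ∏ⱼ θ(ξⱼ) d|μ|(ξ₁) ⋯ d|μ|(ξₘ)` where `dμ = θ d|μ|`. -/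
def integralPow (μ : ComplexMeasure α) (m : ℕ) (f : (Fin m → α) → ℂ) : ℂ :=
  ∫ ξ, f ξ * ∏ j, polar μ (ξ j) ∂(Measure.pi fun _ : Fin m => μ.variation)

end Measures

/-- `M_{μ,ε} = ∫ exp (ε ξ² + 5 |ξ|) d|μ|(ξ)`, possibly infinite. -/
def expMoment {ν : ℕ} (μ : ComplexMeasure (EuclideanSpace ℝ (Fin ν))) (ε : ℝ) : ENNReal :=
  ∫⁻ ξ, ENNReal.ofReal (Real.exp (ε * ‖ξ‖ ^ 2 + 5 * ‖ξ‖)) ∂μ.variation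

/-! ### Ingredients of the tree expansion -/

section Expansion

variable {ν m : ℕ}

/-- `q_{t,υ}(s) = (sh (ω_υ t s) x_υ + sh (ω_υ t (1 - s)) y_υ) / sh (ω_υ t)`. -/
def qPath (ω : Fin ν → ℝ) (t : ℝ) (x y : EuclideanSpace ℂ (Fin ν)) (s : ℝ) (υ : Fin ν) : ℂ :=
  1 / (Real.sinh (ω υ * t) : ℂ) *
    ((Real.sinh (ω υ * t * s) : ℂ) * x υ + (Real.sinh (ω υ * t * (1 - s)) : ℂ) * y υ)

/-- `q_t^m(s) · ξ = q_t(s₁) · ξ₁ + ⋯ + q_t(sₘ) · ξₘ` (bilinear dot products). -/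
def qDot (ω : Fin ν → ℝ) (t : ℝ) (x y : EuclideanSpace ℂ (Fin ν)) (s : Fin m → ℝ)
    (ξ : Fin m → EuclideanSpace ℝ (Fin ν)) : ℂ :=
  ∑ j, ∑ υ, qPath ω t x y (s j) υ * (ξ j υ : ℂ)

/-- `θ_{j,k,g}`: the minimum of `θ_e` over the edges `e` of the path joining `j` and `k` in the
tree `g`. It is used only for `j ≠ k`. -/
def minOnPath (g : SimpleGraph (Fin m)) (θ : g.edgeSet → ℝ) (j k : Fin m) : ℝ :=
  sInf {r | ∃ p : g.Walk j k, p.IsPath ∧ ∃ e : g.edgeSet, (e : Sym2 (Fin m)) ∈ p.edges ∧ θ e = r}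

/-- The quadratic form `Ω_t^{g,θ} . ξ ⊗_m ξ`. For `m = 1` it is `Ω_t . ξ ⊗_1 ξ`. -/
def omegaForm (ω : Fin ν → ℝ) (t : ℝ) (g : SimpleGraph (Fin m)) (θ : g.edgeSet → ℝ)
    (s : Fin m → ℝ) (ξ : Fin m → EuclideanSpace ℝ (Fin ν)) : ℝ :=
  (∑ j, ∑ υ, Real.sinh (ω υ * t * s j) * Real.sinh (ω υ * t * (1 - s j)) /
      (ω υ * Real.sinh (ω υ * t)) * ξ j υ ^ 2) +
    2 * ∑ p : Fin m × Fin m with p.1 < p.2, minOnPath g θ p.1 p.2 *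
      ∑ υ, Real.sinh (ω υ * t * s p.1) * Real.sinh (ω υ * t * (1 - s p.2)) /
        (ω υ * Real.sinh (ω υ * t)) * ξ p.1 υ * ξ p.2 υ

open scoped Classical in
/-- `Υ_t^{g,ξ}`, the product over the edges `[j, k]` of `g`, `j < k`. -/
def upsilon (ω : Fin ν → ℝ) (t : ℝ) (g : SimpleGraph (Fin m))
    (s : Fin m → ℝ) (ξ : Fin m → EuclideanSpace ℝ (Fin ν)) : ℝ :=
  ∏ p : Fin m × Fin m with p.1 < p.2 ∧ g.Adj p.1 p.2,
    ∑ υ, Real.sinh (ω υ * t * s p.1) * Real.sinh (ω υ * t * (1 - s p.2)) /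
      (ω υ * t * Real.sinh (ω υ * t)) * ξ p.1 υ * ξ p.2 υ

/-- The simplex `0 < s₁ < ⋯ < sₘ < 1`. -/
def orderedSimplex (m : ℕ) : Set (Fin m → ℝ) :=
  {s | StrictMono s ∧ ∀ j, s j ∈ Set.Ioo (0 : ℝ) 1}

end Expansion

open scoped Classical in
/-- The function `w_m(t, x, y, h)`, for `m ≥ 1`. For `m = 1` the only tree is the graph with one
vertex, the product `Υ` over its edges is `1`, the cube `[0, 1]^g` is a point, and the formula is
`w_1 = - t ∫ ∫ ∫ (Ω_t . ξ ⊗_1 ξ) exp (- h ϑ Ω_t . ξ ⊗_1 ξ) exp (i q_t(s) · ξ) dϑ dμ(ξ) ds`. -/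
def wTerm {ν : ℕ} (ω : Fin ν → ℝ) (μ : ComplexMeasure (EuclideanSpace ℝ (Fin ν))) (m : ℕ)
    (t : ℝ) (x y : EuclideanSpace ℂ (Fin ν)) (h : ℂ) : ℂ :=
  2 ^ (m - 1) * (-1) ^ m * (t : ℂ) ^ (2 * m - 1) *
    ∑ g : SimpleGraph (Fin m) with g.IsTree,
      ∫ s in orderedSimplex m,
        integralPow μ m fun ξ =>
          ∫ θ in Set.Icc (0 : g.edgeSet → ℝ) 1, ∫ ϑ in Set.Icc (0 : ℝ) 1,
            (upsilon ω t g s ξ : ℂ) * (omegaForm ω t g θ s ξ : ℂ) *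
              Complex.exp (-h * ϑ * omegaForm ω t g θ s ξ) *
              Complex.exp (Complex.I * qDot ω t x y s ξ)

/-- `w = ∑_{m ≥ 1} w_m`. -/
def wSeries {ν : ℕ} (ω : Fin ν → ℝ) (μ : ComplexMeasure (EuclideanSpace ℝ (Fin ν)))
    (t : ℝ) (x y : EuclideanSpace ℂ (Fin ν)) (h : ℂ) : ℂ :=
  ∑' m : ℕ, wTerm ω μ (m + 1) t x y h

end TreeHeat

end

/-! The starting point is the formula `exp (-h a) = ∫ exp (-σ/h) J₀(2√(aσ)) dσ/h` for `a ≥ 0` and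
`Re h > 0` (`integral_exp_mul_bess`). Bessel's integral gives `|J₀(2w)| ≤ exp (2 |Im w|)`, so on the
parabola `S_κ` the function `J₀(2√(aσ))` is at most `exp (2√κ √a)` (`norm_bess_sq_le`). Each `w_m`
is a superposition, with amplitudes independent of `h`, of exponentials `exp (-h ϑ Ω)`, and hence a
Laplace transform of a superposition of Bessel functions.

Convolutions are avoided when passing to `exp w` by an extra parameter. A `BorelFamily` represents
`f * exp (-h a)` for all `a ≥ 0` at once, with bound `C exp (r √a)`. Multiplying `f` by `∫ c exp (-h
A)` amounts to integrating `c` against the family at `a + A`. Since `√(a + A) ≤ √a + √A`, the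
constant `C` gets multiplied by any bound for `∫ |c| exp (r √A)` (`BorelFamily.integral`).
Multiplication by `w` thus costs a fixed factor `β`, the exponential series has total constant `exp
β` (`BorelFamily.exists_exp`), and the value at `a = 0` is the required function.

It remains to bound `β`. With `S = ∑ |ξ_j|`, one has `0 ≤ Ω ≤ (t/4) S²` (`omegaForm_nonneg`,
`omegaForm_le`), so `κ = 1/T` turns the growth in `√Ω` into `exp S`. Positivity of `Ω` holds because
`θ_{j,k,g}` is a superposition of indicators of equivalence relations and the Green function is, up
to a rank one factor, a kernel `min (G_j) (G_k)`. The factors of `Υ` are at most `|ξ_j| |ξ_k| / 4`,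
the sum over trees is controlled by a weighted Cayley bound (`sum_trees_prod_edges_le`), and the
simplex has volume at most `1/m!`. The result is `|w_m| ≤ (m+1) (T² ∫ exp (3|ξ|) d|μ|)^m`, which is
summable under the hypothesis.

Dominated convergence and uniform summation keep all functions jointly continuous and holomorphic on
complex lines. Osgood's lemma then gives joint analyticity. -/

noncomputable section

namespace TreeHeat

/-! ### Osgood's lemma -/

section Osgood

open Metric

/-- Cauchy's integral formula on a polydisc. -/
theorem torusIntegral_cauchy {d : ℕ} {c w : Fin d → ℂ} {R : ℝ} (hR : 0 < R)
    (hw : w ∈ ball c R) {f : (Fin d → ℂ) → ℂ} (hf : ContinuousOn f (closedBall c R))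
    (hd : ∀ z ∈ closedBall c R, ∀ i, DifferentiableAt ℂ (fun l => f (Function.update z i l)) (z i)) :
    (∯ z in T(c, fun _ => R), f z * ∏ j, (z j - w j)⁻¹) = (2 * Real.pi * Complex.I) ^ d * f w := by
  induction d with
  | zero => simp [Subsingleton.elim w c]
  | succ d ih =>
    have hmem : ∀ θ, torusMap c (fun _ => R) θ ∈ closedBall c R := by
      intro θ
      rw [mem_closedBall, dist_pi_le_iff hR.le]
      intro i
      simp [torusMap, Complex.norm_exp, abs_of_pos hR]
    have hwj : ∀ j, dist (w j) (c j) < R := (dist_pi_lt_iff hR).1 hw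
    have hne : ∀ θ j, torusMap c (fun _ => R) θ j - w j ≠ 0 := by
      intro θ j h
      have h1 := hwj j
      rw [← sub_eq_zero.1 h] at h1
      simp [torusMap, Complex.norm_exp, abs_of_pos hR] at h1
    have hcm : Continuous fun θ => torusMap c (fun _ => R) θ := by
      unfold torusMap; fun_prop
    have hint : TorusIntegrable (fun z => f z * ∏ j, (z j - w j)⁻¹) c (fun _ => R) := by
      refine Continuous.integrableOn_Icc ?_
      refine Continuous.mul ?_ (continuous_finsetProd _ fun j _ => ?_)
      · exact hf.comp_continuous hcm hmem
      · exact Continuous.inv₀ (((continuous_apply j).comp hcm).sub continuous_const)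
          (fun θ => hne θ j)
    rw [torusIntegral_succ hint]
    have hcons : ∀ x ∈ closedBall (c 0) R, ∀ y ∈ closedBall (c ∘ Fin.succ) R,
        (Fin.cons x y : Fin (d + 1) → ℂ) ∈ closedBall c R := by
      intro x hx y hy
      rw [mem_closedBall, dist_pi_le_iff hR.le] at *
      intro i
      refine Fin.cases ?_ (fun i => ?_) i
      · simpa using hx
      · simpa using hy i
    have hwtail : w ∘ Fin.succ ∈ ball (c ∘ Fin.succ) R := by
      rw [mem_ball, dist_pi_lt_iff hR]
      exact fun i => hwj i.succ
    have hcc : Continuous fun p : ℂ × (Fin d → ℂ) => (Fin.cons p.1 p.2 : Fin (d + 1) → ℂ) := by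
      refine continuous_pi fun i => ?_
      refine Fin.cases ?_ (fun i => ?_) i
      · simpa using continuous_fst
      · simp only [Fin.cons_succ]
        fun_prop
    -- For a fixed first coordinate the induction hypothesis evaluates the integral over the others;
    -- the one-variable Cauchy formula then treats the remaining circle.
    have inner : ∀ x ∈ sphere (c 0) R,
        (∯ y in T(c ∘ Fin.succ, (fun _ : Fin (d + 1) => R) ∘ Fin.succ),
          f (Fin.cons x y) * ∏ j, ((Fin.cons x y : Fin (d + 1) → ℂ) j - w j)⁻¹) =
        (2 * Real.pi * Complex.I) ^ d * ((x - w 0)⁻¹ • f (Fin.cons x (w ∘ Fin.succ))) := by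
      intro x hx
      have hx' := sphere_subset_closedBall hx
      have := ih hwtail (f := fun y => f (Fin.cons x y))
        (hf.comp (hcc.comp (Continuous.prodMk_right x)).continuousOn
          fun y hy => hcons x hx' y hy)
        (fun z hz i => by
          have := hd _ (hcons x hx' z hz) i.succ
          simpa [Fin.cons_update] using this)
      rw [smul_eq_mul, mul_left_comm, ← this, ← torusIntegral_const_mul]
      congr 1
      ext y
      simp only [Fin.prod_univ_succ, Fin.cons_zero, Fin.cons_succ, Function.comp]
      ring
    rw [circleIntegral.integral_congr hR.le inner]
    rw [circleIntegral.integral_const_mul]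
    have h0 : w 0 ∈ ball (c 0) R := hwj 0
    rw [Complex.circleIntegral_sub_inv_smul_of_differentiable_on_off_countable
      Set.countable_empty h0 (f := fun x => f (Fin.cons x (w ∘ Fin.succ)))]
    · have : (Fin.cons (w 0) (w ∘ Fin.succ) : Fin (d + 1) → ℂ) = w := Fin.cons_self_tail w
      rw [this, smul_eq_mul, pow_succ, mul_assoc _ (2 * _ * _)]
    · exact hf.comp (hcc.comp (Continuous.prodMk_left _)).continuousOn
          fun y hy => hcons y hy _ (ball_subset_closedBall hwtail)
    · intro x hx
      have := hd _ (hcons x (ball_subset_closedBall hx.1) _ (ball_subset_closedBall hwtail)) 0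
      simpa [Fin.update_cons_zero] using this

/-- The kernel is regarded as one element of the Banach algebra `C(K, ℂ)`. Each factor is affine in
`z` with unit values on the polydisc, and inversion is analytic at units. Values in `C(K, ℂ)` allow
a later integration by a continuous linear functional. -/
theorem analyticAt_torus_kernel {d : ℕ} {c w : Fin d → ℂ} {R : ℝ} (hR : 0 < R)
    (hw : w ∈ ball c R) {K : Type*} [TopologicalSpace K] [CompactSpace K]
    (τ : C(K, Fin d → ℂ)) (hτ : ∀ k j, dist (τ k j) (c j) = R) :
    ∃ Φ : (Fin d → ℂ) → C(K, ℂ), AnalyticAt ℂ Φ w ∧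
      ∀ z ∈ ball c R, ∀ k, Φ z k = ∏ j, (τ k j - z j)⁻¹ := by
  let X : Fin d → (Fin d → ℂ) → C(K, ℂ) := fun j z =>
    (⟨fun k => τ k j, (continuous_apply j).comp τ.continuous⟩ : C(K, ℂ)) - algebraMap ℂ C(K, ℂ) (z j)
  have hX : ∀ j z k, X j z k = τ k j - z j := fun j z k => by simp [X]
  have hu : ∀ z ∈ ball c R, ∀ j, IsUnit (X j z) := by
    intro z hz j
    rw [ContinuousMap.isUnit_iff_forall_ne_zero]
    intro k h
    rw [hX, sub_eq_zero] at h
    have h1 := (dist_pi_lt_iff hR).1 hz j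
    rw [← h, hτ] at h1
    exact lt_irrefl _ h1
  refine ⟨fun z => ∏ j, Ring.inverse (X j z), ?_, ?_⟩
  · refine Finset.analyticAt_fun_prod _ fun j _ => ?_
    have h1 : AnalyticAt ℂ (X j) w := by
      refine analyticAt_const.sub ?_
      exact ((Algebra.linearMap ℂ C(K, ℂ)).toContinuousLinearMap.comp
        (ContinuousLinearMap.proj (R := ℂ) (φ := fun _ : Fin d => ℂ) j)).analyticAt w
    obtain ⟨u, hu'⟩ := hu w hw j
    refine AnalyticAt.comp (g := Ring.inverse) (f := X j) ?_ h1
    rw [← hu']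
    exact analyticAt_inverse u
  · intro z hz k
    rw [ContinuousMap.prod_apply]
    refine Finset.prod_congr rfl fun j _ => ?_
    have h := congrArg (fun g : C(K, ℂ) => g k) (Ring.mul_inverse_cancel _ (hu z hz j))
    simp only [ContinuousMap.mul_apply, ContinuousMap.one_apply, hX] at h
    exact eq_inv_of_mul_eq_one_right h

/-- Near the centre, Cauchy's formula writes `f` as a continuous linear functional on `C(B, ℂ)`
applied to the analytic kernel `Φ`. -/
theorem analyticAt_pi_of_separately {d : ℕ} {c : Fin d → ℂ} {R : ℝ} (hR : 0 < R)
    {f : (Fin d → ℂ) → ℂ} (hf : ContinuousOn f (closedBall c R))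
    (hd : ∀ z ∈ closedBall c R, ∀ i, DifferentiableAt ℂ (fun l => f (Function.update z i l)) (z i)) :
    AnalyticAt ℂ f c := by
  let B : Set (Fin d → ℝ) := Set.Icc 0 fun _ => 2 * Real.pi
  have hcm : Continuous fun θ : Fin d → ℝ => torusMap c (fun _ => R) θ := by
    unfold torusMap; fun_prop
  have hmem : ∀ θ, torusMap c (fun _ => R) θ ∈ closedBall c R := by
    intro θ
    rw [mem_closedBall, dist_pi_le_iff hR.le]
    intro i
    simp [torusMap, Complex.norm_exp, abs_of_pos hR]
  have : CompactSpace B := isCompact_iff_compactSpace.1 isCompact_Icc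
  obtain ⟨Φ, hΦ, hΦ'⟩ := analyticAt_torus_kernel hR (c := c) (mem_ball_self hR) (K := B)
    ⟨fun θ => torusMap c (fun _ => R) θ, hcm.comp continuous_subtype_val⟩
    (fun k j => by simp [torusMap, Complex.norm_exp, abs_of_pos hR])
  let G : B → ℂ := fun θ => (∏ i : Fin d, (R : ℂ) * Complex.exp (θ.1 i * Complex.I) * Complex.I) *
    f (torusMap c (fun _ => R) θ)
  have hG : Continuous G := by
    refine Continuous.mul (continuous_finsetProd _ fun i _ => ?_) ?_
    · have : Continuous fun θ : B => θ.1 i := (continuous_apply i).comp continuous_subtype_val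
      exact (continuous_const.mul (Complex.continuous_exp.comp
        ((Complex.continuous_ofReal.comp this).mul continuous_const))).mul continuous_const
    · exact hf.comp_continuous (hcm.comp continuous_subtype_val) fun _ => hmem _
  let vol : Measure B := Measure.comap Subtype.val volume
  have : IsFiniteMeasure vol := by
    refine ⟨?_⟩
    rw [comap_subtype_coe_apply measurableSet_Icc]
    exact (measure_mono (Subtype.coe_image_subset _ _)).trans_lt isCompact_Icc.measure_lt_top
  have hint : ∀ g : C(B, ℂ), Integrable (fun θ => G θ * g θ) vol := fun g =>
    (hG.mul g.continuous).integrable_of_hasCompactSupport (HasCompactSupport.of_compactSpace _)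
  let Λ : C(B, ℂ) →L[ℂ] ℂ := LinearMap.mkContinuous
    { toFun := fun g => ∫ θ, G θ * g θ ∂vol
      map_add' := fun g g' => by
        simp only [ContinuousMap.add_apply, mul_add]
        exact integral_add (hint g) (hint g')
      map_smul' := fun a g => by
        simp only [ContinuousMap.smul_apply, smul_eq_mul, RingHom.id_apply, mul_left_comm]
        exact integral_const_mul _ _ }
    (∫ θ, ‖G θ‖ ∂vol) (fun g => by
      simp only [LinearMap.coe_mk, AddHom.coe_mk]
      rw [← integral_mul_const]
      refine norm_integral_le_of_norm_le ?_ (Filter.Eventually.of_forall fun θ => ?_)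
      · have := (hint 1).norm
        simp only [ContinuousMap.one_apply, mul_one] at this
        exact this.mul_const _
      · rw [norm_mul]
        gcongr
        exact g.norm_coe_le_norm θ)
  have hA : AnalyticAt ℂ (fun z => ((2 * Real.pi * Complex.I) ^ d)⁻¹ * Λ (Φ z)) c :=
    analyticAt_const.mul ((Λ.analyticAt _).comp hΦ)
  refine hA.congr ?_
  filter_upwards [ball_mem_nhds c hR] with w hw
  have h2 : (2 * Real.pi * Complex.I) ^ d ≠ 0 := pow_ne_zero _ Complex.two_pi_I_ne_zero
  rw [inv_mul_eq_iff_eq_mul₀ h2, ← torusIntegral_cauchy hR hw hf hd]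
  simp only [torusIntegral, smul_eq_mul]
  change ∫ θ, G θ * Φ w θ ∂vol = _
  rw [← integral_subtype_comap measurableSet_Icc]
  refine integral_congr_ae (Filter.Eventually.of_forall fun θ => ?_)
  simp only [G, hΦ' w hw]
  simp [mul_assoc]

/-- **Osgood's lemma**: a continuous function which is holomorphic along complex lines is
analytic. -/
theorem analyticOnNhd_of_lineDifferentiableAt {E : Type*} [NormedAddCommGroup E] [NormedSpace ℂ E]
    [FiniteDimensional ℂ E] {f : E → ℂ} {U : Set E} (hU : IsOpen U) (hf : ContinuousOn f U)
    (hd : ∀ z ∈ U, ∀ v, LineDifferentiableAt ℂ f z v) : AnalyticOnNhd ℂ f U := by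
  intro z hz
  let e : E ≃L[ℂ] (Fin (Module.finrank ℂ E) → ℂ) := (Module.finBasis ℂ E).equivFunL
  have hV : IsOpen (e.symm ⁻¹' U) := hU.preimage e.symm.continuous
  obtain ⟨R, hR, hRU⟩ := nhds_basis_closedBall.mem_iff.1
    (hV.mem_nhds (show e z ∈ e.symm ⁻¹' U by simpa using hz))
  have key : AnalyticAt ℂ (f ∘ e.symm) (e z) := by
    refine analyticAt_pi_of_separately hR
      (hf.comp e.symm.continuous.continuousOn fun w hw => hRU hw) fun w hw i => ?_
    have h := hd _ (hRU hw) (e.symm (Pi.single i 1))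
    have h1 : DifferentiableAt ℂ (fun l : ℂ => l - w i) (w i) := by fun_prop
    have h2 : DifferentiableAt ℂ
        (fun t : ℂ => f (e.symm w + t • e.symm (Pi.single i 1))) ((fun l : ℂ => l - w i) (w i)) := by
      simpa [LineDifferentiableAt] using h
    refine (DifferentiableAt.comp (f := fun l => l - w i) (w i) h2 h1).congr_of_eventuallyEq (Filter.Eventually.of_forall fun l => ?_)
    simp only [Function.comp]
    rw [← map_smul, ← map_add]
    congr 2
    ext j
    rcases eq_or_ne j i with rfl | hj
    · simp
    · simp [hj]
  have := key.comp (f := e) (e.analyticAt z)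
  refine this.congr (Filter.Eventually.of_forall fun w => ?_)
  simp

end Osgood

/-! ### The Bessel function `u ↦ J₀ (2 √u)` and its Laplace transform -/

section Bessel

/-- The entire function `u ↦ J₀ (2 √u)`. -/
def bess (u : ℂ) : ℂ := ∑' n : ℕ, (-u) ^ n / (n.factorial : ℂ) ^ 2

theorem norm_bess_term_le (u : ℂ) (n : ℕ) :
    ‖(-u) ^ n / (n.factorial : ℂ) ^ 2‖ ≤ ‖u‖ ^ n / n.factorial := by
  rw [norm_div, norm_pow, norm_neg, norm_pow, Complex.norm_natCast]
  have h1 : (1 : ℝ) ≤ n.factorial := by exact_mod_cast Nat.one_le_iff_ne_zero.2 n.factorial_ne_zero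
  have h2 : (n.factorial : ℝ) ≤ (n.factorial : ℝ) ^ 2 := by nlinarith
  gcongr

theorem hasSum_bess (u : ℂ) : HasSum (fun n : ℕ => (-u) ^ n / (n.factorial : ℂ) ^ 2) (bess u) :=
  (Summable.of_norm_bounded (Real.summable_pow_div_factorial ‖u‖) (norm_bess_term_le u)).hasSum

theorem differentiable_bess : Differentiable ℂ bess := by
  intro u
  have := Complex.differentiableOn_tsum_of_summable_norm (U := Metric.ball (0 : ℂ) (‖u‖ + 1))
    (F := fun (n : ℕ) (u : ℂ) => (-u) ^ n / (n.factorial : ℂ) ^ 2)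
    (Real.summable_pow_div_factorial (‖u‖ + 1)) (fun n => by fun_prop) Metric.isOpen_ball
    (fun n w hw => (norm_bess_term_le w n).trans (by
      have : ‖w‖ ≤ ‖u‖ + 1 := (mem_ball_zero_iff.1 hw).le
      gcongr))
  exact this.differentiableAt (Metric.isOpen_ball.mem_nhds (by simp))

theorem norm_cos_le_exp (z : ℂ) : ‖Complex.cos z‖ ≤ Real.exp |z.im| := by
  rw [Complex.cos, norm_div]
  have h1 : ‖Complex.exp (z * Complex.I)‖ ≤ Real.exp |z.im| := by
    rw [Complex.norm_exp, Real.exp_le_exp]; simpa using neg_le_abs z.im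
  have h2 : ‖Complex.exp (-z * Complex.I)‖ ≤ Real.exp |z.im| := by
    rw [Complex.norm_exp, Real.exp_le_exp]; simpa using le_abs_self z.im
  have := norm_add_le (Complex.exp (z * Complex.I)) (Complex.exp (-z * Complex.I))
  simp only [Complex.norm_ofNat]
  linarith

/-- Bessel's integral for `J₀(2w)`: the cosine series is integrated term by term, each even power of
the sine giving a Wallis product. -/
theorem bess_sq_eq_integral (w : ℂ) :
    (Real.pi : ℂ) * bess (w ^ 2) = ∫ x in (0 : ℝ)..Real.pi, Complex.cos (2 * w * Real.sin x) := by
  have wallis : ∀ n : ℕ, (4 : ℝ) ^ n / (2 * n).factorial *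
      ∏ i ∈ Finset.range n, ((2 * i + 1 : ℝ) / (2 * i + 2)) = 1 / (n.factorial : ℝ) ^ 2 := by
    intro n
    induction n with
    | zero => simp
    | succ n ih =>
      rw [Finset.prod_range_succ, show 2 * (n + 1) = 2 * n + 1 + 1 by ring, Nat.factorial_succ,
        Nat.factorial_succ, Nat.factorial_succ n, pow_succ]
      have e : (4 : ℝ) ^ n * 4 / (((2 * n + 1 + 1) * ((2 * n + 1) * (2 * n).factorial) : ℕ) : ℝ) *
          ((∏ i ∈ Finset.range n, ((2 * i + 1 : ℝ) / (2 * i + 2))) * ((2 * n + 1) / (2 * n + 2))) =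
          ((4 : ℝ) ^ n / (2 * n).factorial *
          ∏ i ∈ Finset.range n, ((2 * i + 1 : ℝ) / (2 * i + 2))) * (1 / (n + 1) ^ 2) := by
        have := Nat.factorial_ne_zero (2 * n)
        generalize (∏ i ∈ Finset.range n, ((2 * i + 1 : ℝ) / (2 * i + 2))) = P
        push_cast
        field_simp
        ring
      rw [e, ih]
      push_cast
      field_simp
  have hs : HasSum (fun n : ℕ => ∫ x in (0 : ℝ)..Real.pi,
      (-1) ^ n * (2 * w * Real.sin x) ^ (2 * n) / ((2 * n).factorial : ℂ))
      (∫ x in (0 : ℝ)..Real.pi, Complex.cos (2 * w * Real.sin x)) := by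
    have hsum : Summable fun n : ℕ => (2 * ‖w‖) ^ (2 * n) / ((2 * n).factorial : ℝ) :=
      (Real.summable_pow_div_factorial (2 * ‖w‖)).comp_injective
        (mul_right_injective₀ two_ne_zero)
    refine intervalIntegral.hasSum_integral_of_dominated_convergence
      (fun n _ => (2 * ‖w‖) ^ (2 * n) / ((2 * n).factorial : ℝ)) (fun n => ?_) (fun n => ?_)
      ?_ ?_ ?_
    · exact Continuous.aestronglyMeasurable (by fun_prop)
    · refine Filter.Eventually.of_forall fun x _ => ?_
      simp only [norm_div, norm_mul, norm_pow, norm_neg, norm_one, one_pow, one_mul,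
        Complex.norm_natCast, Complex.norm_real, Complex.norm_ofNat]
      have : 2 * ‖w‖ * ‖Real.sin x‖ ≤ 2 * ‖w‖ :=
        mul_le_of_le_one_right (by positivity) (Real.abs_sin_le_one x)
      gcongr
    · exact Filter.Eventually.of_forall fun x _ => hsum
    · exact intervalIntegrable_const
    · exact Filter.Eventually.of_forall fun x _ => Complex.hasSum_cos _
  have e : ∀ n : ℕ, ∫ x in (0 : ℝ)..Real.pi,
      (-1) ^ n * (2 * w * Real.sin x) ^ (2 * n) / ((2 * n).factorial : ℂ) =
      Real.pi * ((-w ^ 2) ^ n / (n.factorial : ℂ) ^ 2) := by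
    intro n
    have h1 : ∀ x : ℝ, (-1) ^ n * (2 * w * Real.sin x) ^ (2 * n) / ((2 * n).factorial : ℂ) =
        ((-w ^ 2) ^ n * 4 ^ n / ((2 * n).factorial : ℂ)) * ((Real.sin x ^ (2 * n) : ℝ) : ℂ) := by
      intro x
      push_cast
      rw [mul_pow, mul_pow, pow_mul 2 2 n, pow_mul w, neg_pow (w ^ 2)]
      norm_num
      ring
    simp_rw [h1]
    rw [intervalIntegral.integral_const_mul, intervalIntegral.integral_ofReal,
      integral_sin_pow_even]
    have := congrArg (fun x : ℝ => (x : ℂ)) (wallis n)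
    push_cast at this
    push_cast
    calc _ = Real.pi * (-w ^ 2) ^ n * (4 ^ n / ((2 * n).factorial : ℂ) *
        ∏ x ∈ Finset.range n, ((2 * x + 1 : ℂ) / (2 * x + 2))) := by ring
      _ = _ := by rw [this]; ring
  simp_rw [e] at hs
  exact ((hasSum_bess (w ^ 2)).mul_left _).unique hs

/-- The power series alone would only give growth in `|w|`. Growth in `|Im w|` alone is what makes
the function bounded in `σ` on a parabola. -/
theorem norm_bess_sq_le (w : ℂ) : ‖bess (w ^ 2)‖ ≤ Real.exp (2 * |w.im|) := by
  have h : ‖∫ x in (0 : ℝ)..Real.pi, Complex.cos (2 * w * Real.sin x)‖ ≤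
      Real.exp (2 * |w.im|) * |Real.pi - 0| := by
    refine intervalIntegral.norm_integral_le_of_norm_le_const fun x _ => ?_
    refine (norm_cos_le_exp _).trans (Real.exp_le_exp.2 ?_)
    rw [Complex.im_mul_ofReal, abs_mul]
    have : |(2 * w).im| = 2 * |w.im| := by simp [abs_mul]
    rw [this]
    exact mul_le_of_le_one_right (by positivity) (Real.abs_sin_le_one x)
  rw [← bess_sq_eq_integral, norm_mul, Complex.norm_real, Real.norm_eq_abs, sub_zero,
    mul_comm] at h
  exact le_of_mul_le_mul_right h (abs_pos.2 Real.pi_ne_zero)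

theorem integrableOn_pow_mul_exp {p : ℂ} (hp : 0 < p.re) (n : ℕ) :
    IntegrableOn (fun x : ℝ => (x : ℂ) ^ n * Complex.exp (-p * x)) (Set.Ioi 0) := by
  have h := integrableOn_rpow_mul_exp_neg_mul_rpow (p := 1) (s := n) (b := p.re)
    (by have : (0 : ℝ) ≤ n := n.cast_nonneg
        linarith) one_pos hp
  refine h.mono' (Continuous.aestronglyMeasurable (by fun_prop)) ?_
  refine (ae_restrict_mem measurableSet_Ioi).mono fun x hx => ?_
  rw [norm_mul, norm_pow, Complex.norm_real, Complex.norm_exp, Real.norm_of_nonneg (le_of_lt hx)]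
  simp

theorem integral_pow_mul_exp {p : ℂ} (hp : 0 < p.re) (n : ℕ) :
    ∫ x in Set.Ioi (0 : ℝ), (x : ℂ) ^ n * Complex.exp (-p * x) = n.factorial / p ^ (n + 1) := by
  have hp0 : p ≠ 0 := by rintro rfl; simp at hp
  have ht : ∀ n : ℕ, Filter.Tendsto (fun x : ℝ => -((x : ℂ) ^ n * Complex.exp (-p * x)) / p)
      Filter.atTop (nhds 0) := by
    intro n
    have h := tendsto_rpow_mul_exp_neg_mul_atTop_nhds_zero n p.re hp
    have h1 : Filter.Tendsto (fun x : ℝ => (x : ℂ) ^ n * Complex.exp (-p * x))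
        Filter.atTop (nhds 0) := by
      refine squeeze_zero_norm' ?_ h
      filter_upwards [Filter.eventually_gt_atTop 0] with x hx
      rw [norm_mul, norm_pow, Complex.norm_real, Complex.norm_exp, Real.norm_of_nonneg hx.le]
      simp
    simpa using h1.neg.div_const p
  -- Integration by parts in the form of an antiderivative. The truncated exponent `n - 1` is
  -- harmless at `n = 0`, because of the factor `n`.
  have hd : ∀ (n : ℕ) (x : ℝ), HasDerivAt (fun x : ℝ => -((x : ℂ) ^ n * Complex.exp (-p * x)) / p)
      ((x : ℂ) ^ n * Complex.exp (-p * x) -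
        n / p * ((x : ℂ) ^ (n - 1) * Complex.exp (-p * x))) x := by
    intro n x
    have h1 : HasDerivAt (fun z : ℂ => -(z ^ n * Complex.exp (-p * z)) / p)
        (-((n * (x : ℂ) ^ (n - 1)) * Complex.exp (-p * x) +
          (x : ℂ) ^ n * (Complex.exp (-p * x) * (-p * 1))) / p) (x : ℂ) :=
      ((((hasDerivAt_pow n (x : ℂ))).mul
        (((hasDerivAt_id (x : ℂ)).const_mul (-p)).cexp)).neg.div_const p)
    convert h1.comp_ofReal using 1
    field_simp
    ring
  induction n with
  | zero =>
    have := integral_Ioi_of_hasDerivAt_of_tendsto (a := 0)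
      (by exact Continuous.continuousWithinAt (by fun_prop)) (fun x _ => hd 0 x)
      (by simpa using integrableOn_pow_mul_exp hp 0) (ht 0)
    simp only [CharP.cast_eq_zero, zero_div, zero_mul, sub_zero] at this
    rw [this]
    simp [neg_div]
  | succ n ih =>
    have := integral_Ioi_of_hasDerivAt_of_tendsto (a := 0)
      (by exact Continuous.continuousWithinAt (by fun_prop)) (fun x _ => hd (n + 1) x)
      ((integrableOn_pow_mul_exp hp (n + 1)).sub ((integrableOn_pow_mul_exp hp n).const_mul _))
      (ht (n + 1))
    simp only [Nat.add_sub_cancel] at this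
    rw [integral_sub (integrableOn_pow_mul_exp hp (n + 1))
      ((integrableOn_pow_mul_exp hp n).const_mul _), integral_const_mul, ih] at this
    simp only [Complex.ofReal_zero, zero_pow n.succ_ne_zero, zero_mul, neg_zero, zero_div,
      sub_zero, sub_eq_zero] at this
    rw [this, Nat.factorial_succ]
    push_cast
    field_simp
    ring

/-- The Borel transform of `h ↦ exp (- h a)` is `σ ↦ J₀ (2 √(a σ))`. -/
theorem integral_exp_mul_bess {a : ℝ} {h : ℂ} (hh : 0 < h.re) (ha : 0 ≤ a) :
    ∫ σ in Set.Ioi (0 : ℝ), Complex.exp (-σ / h) * bess (a * σ) / h = Complex.exp (-h * a) := by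
  have h0 : h ≠ 0 := by rintro rfl; simp at hh
  have hp : 0 < (h⁻¹).re := by
    rw [Complex.inv_re]; exact div_pos hh (Complex.normSq_pos.2 h0)
  -- The Bessel series is integrated term by term: the integral of `σ ^ n` produces one `n!`, which
  -- reduces `(n!)²` to the denominator of the exponential series. The norms integrate by the same
  -- formula with `p = Re (1/h)`.
  let F : ℕ → ℝ → ℂ := fun n σ => ((-a) ^ n / (n.factorial : ℂ) ^ 2 / h) *
    ((σ : ℂ) ^ n * Complex.exp (-h⁻¹ * σ))
  have hFi : ∀ n, Integrable (F n) (volume.restrict (Set.Ioi 0)) := fun n =>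
    (integrableOn_pow_mul_exp hp n).const_mul _
  have hnorm : ∀ n, ∫ σ in Set.Ioi (0 : ℝ), ‖F n σ‖ =
      (1 / (‖h‖ * h⁻¹.re)) * ((a / h⁻¹.re) ^ n / n.factorial) := by
    intro n
    have e : ∀ σ ∈ Set.Ioi (0 : ℝ), ((‖F n σ‖ : ℝ) : ℂ) =
        ((a ^ n / (n.factorial : ℝ) ^ 2 / ‖h‖ : ℝ) : ℂ) *
          ((σ : ℂ) ^ n * Complex.exp (-(h⁻¹.re : ℂ) * σ)) := by
      intro σ hσ
      have : ‖F n σ‖ = (a ^ n / (n.factorial : ℝ) ^ 2 / ‖h‖) *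
          (σ ^ n * Real.exp (-h⁻¹.re * σ)) := by
        simp only [F, norm_mul, norm_div, norm_pow, norm_neg, Complex.norm_real,
          Complex.norm_natCast, Complex.norm_exp, Real.norm_of_nonneg ha,
          Real.norm_of_nonneg (le_of_lt hσ)]
        simp
      rw [this]; push_cast; rfl
    have h2 : ((∫ σ in Set.Ioi (0 : ℝ), ‖F n σ‖ : ℝ) : ℂ) =
        (((1 / (‖h‖ * h⁻¹.re)) * ((a / h⁻¹.re) ^ n / n.factorial) : ℝ) : ℂ) := by
      rw [← integral_complex_ofReal, setIntegral_congr_fun measurableSet_Ioi e, integral_const_mul,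
        integral_pow_mul_exp (by simpa using hp)]
      rw [← Complex.ofReal_natCast, ← Complex.ofReal_pow, ← Complex.ofReal_div,
        ← Complex.ofReal_mul]
      congr 1
      have := n.factorial_ne_zero
      have := hp.ne'
      have := norm_ne_zero_iff.2 h0
      rw [div_pow, pow_succ]
      generalize h⁻¹.re = q at *
      field_simp
      ring
    exact_mod_cast h2
  have hsum : Summable fun n => ∫ σ in Set.Ioi (0 : ℝ), ‖F n σ‖ := by
    simp_rw [hnorm]
    exact (Real.summable_pow_div_factorial _).mul_left _
  have key := hasSum_integral_of_summable_integral_norm hFi hsum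
  have e1 : ∀ σ : ℝ, ∑' n, F n σ = Complex.exp (-σ / h) * bess (a * σ) / h := by
    intro σ
    have := ((hasSum_bess (a * σ)).mul_left (Complex.exp (-σ / h) / h)).tsum_eq
    rw [mul_comm (Complex.exp _), mul_div_assoc, mul_comm, ← this]
    refine tsum_congr fun n => ?_
    simp only [F, ← neg_mul, mul_pow]
    rw [show -h⁻¹ * σ = -σ / h by ring]
    ring
  have e2 : ∀ n, ∫ σ in Set.Ioi (0 : ℝ), F n σ = (-h * a) ^ n / n.factorial := by
    intro n
    simp only [F]
    rw [integral_const_mul, integral_pow_mul_exp hp]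
    have : (n.factorial : ℂ) ≠ 0 := by exact_mod_cast n.factorial_ne_zero
    rw [show -h * (a : ℂ) = h * (-a) by ring, mul_pow, inv_pow, div_inv_eq_mul, pow_succ]
    field_simp
    ring
  simp_rw [e1, e2] at key
  rw [← key.tsum_eq, Complex.exp_eq_exp_ℂ, NormedSpace.exp_eq_tsum_div]

end Bessel

/-! ### Borel transforms depending on parameters -/

section BorelFamily

open Metric

/-- The integral of a dominated family of holomorphic functions is holomorphic. -/
theorem differentiableAt_integral_of_dominated {Z : Type*} [MeasurableSpace Z] {ρ : Measure Z}
    {F : ℂ → Z → ℂ} {D : Z → ℝ} {δ : ℝ} (hδ : 0 < δ)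
    (hm : ∀ l ∈ ball (0 : ℂ) δ, AEStronglyMeasurable (F l) ρ)
    (hb : ∀ᵐ η ∂ρ, ∀ l ∈ ball (0 : ℂ) δ, ‖F l η‖ ≤ D η) (hD : Integrable D ρ)
    (hd : ∀ η, ∀ l ∈ ball (0 : ℂ) δ, DifferentiableAt ℂ (fun l => F l η) l) :
    DifferentiableAt ℂ (fun l => ∫ η, F l η ∂ρ) 0 := by
  have hsub : ball (0 : ℂ) (δ / 2) ⊆ ball 0 δ := ball_subset_ball (by linarith)
  have h0 : (0 : ℂ) ∈ ball (0 : ℂ) δ := mem_ball_self hδ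
  -- Circles of radius `δ / 4` about points of the half-size ball stay in the large ball, so
  -- Cauchy's estimate converts the bound `D` on values into `D / (δ / 4)` on derivatives.
  refine (hasDerivAt_integral_of_dominated_loc_of_deriv_le (s := ball (0 : ℂ) (δ / 2))
    (F' := fun l η => deriv (fun l => F l η) l) (bound := fun η => D η / (δ / 4))
    (ball_mem_nhds 0 (by positivity)) ?_ ?_ ?_ ?_ ?_ ?_).2.differentiableAt
  · filter_upwards [ball_mem_nhds (0 : ℂ) hδ] with l hl using hm l hl
  · exact hD.mono' (hm 0 h0) (hb.mono fun η h => h 0 h0)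
  -- The derivative at `0` is measurable in `η` as a limit of difference quotients along the
  -- sequence `u`.
  · let u : ℕ → ℂ := fun n => ((δ / 2 / (n + 1) : ℝ) : ℂ)
    have hu : ∀ n, u n ∈ ball (0 : ℂ) δ := by
      intro n
      have h1 : δ / 2 / ((n : ℝ) + 1) ≤ δ / 2 := div_le_self (by positivity) (by simp)
      rw [mem_ball_zero_iff, Complex.norm_real, Real.norm_of_nonneg (by positivity)]
      linarith
    have hu0 : ∀ n, u n ≠ 0 := by
      intro n
      simp only [u, ne_eq, Complex.ofReal_eq_zero]
      positivity
    have hlim : Filter.Tendsto u Filter.atTop (nhdsWithin 0 {0}ᶜ) := by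
      refine tendsto_nhdsWithin_iff.2 ⟨?_, Filter.Eventually.of_forall hu0⟩
      have : Filter.Tendsto (fun n : ℕ => δ / 2 / ((n : ℝ) + 1)) Filter.atTop (nhds 0) := by
        simpa using (tendsto_one_div_add_atTop_nhds_zero_nat (𝕜 := ℝ)).const_mul (δ / 2)
          |>.congr fun n => by ring
      have h2 := (Complex.continuous_ofReal.tendsto 0).comp this
      simpa [u, Function.comp_def] using h2
    refine aestronglyMeasurable_of_tendsto_ae Filter.atTop
      (f := fun n η => slope (fun l => F l η) 0 (u n)) (fun n => ?_)
      (Filter.Eventually.of_forall fun η => ?_)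
    · simp only [slope_def_module]
      exact ((hm _ (hu n)).sub (hm 0 h0)).const_smul ((u n - 0)⁻¹)
    · exact (hasDerivAt_iff_tendsto_slope.1 (hd η 0 h0).hasDerivAt).comp hlim
  · filter_upwards [hb] with η hη l hl
    have hcl : closedBall l (δ / 4) ⊆ ball 0 δ := by
      refine closedBall_subset_ball' ?_
      have := mem_ball.1 hl
      linarith
    refine Complex.norm_deriv_le_of_forall_mem_sphere_norm_le (by positivity) ?_
      fun z hz => hη z (hcl (sphere_subset_closedBall hz))
    refine DifferentiableOn.diffContOnCl fun z hz => ?_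
    rw [closure_ball _ (by positivity)] at hz
    exact (hd η z (hcl hz)).differentiableWithinAt
  · exact hD.div_const _
  · exact Filter.Eventually.of_forall fun η l hl => (hd η l (hsub hl)).hasDerivAt

theorem LineDifferentiableAt.differentiableAt_line {E : Type*} [AddCommGroup E] [Module ℂ E]
    {f : E → ℂ} {z w : E} {l : ℂ} (h : LineDifferentiableAt ℂ f (z + l • w) w) :
    DifferentiableAt ℂ (fun l : ℂ => f (z + l • w)) l := by
  have h1 : DifferentiableAt ℂ (fun t : ℂ => f (z + l • w + t • w)) ((fun x : ℂ => x - l) l) := by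
    simpa [LineDifferentiableAt] using h
  refine (DifferentiableAt.comp (f := fun x : ℂ => x - l) l h1 (by fun_prop)).congr_of_eventuallyEq
    (Filter.Eventually.of_forall fun x => ?_)
  simp only [Function.comp]
  congr 1
  module

theorem exists_ball_line_mem {E : Type*} [NormedAddCommGroup E] [NormedSpace ℂ E] {U : Set E}
    (hU : IsOpen U) {z : E} (hz : z ∈ U) (w : E) :
    ∃ δ > 0, ∀ l ∈ ball (0 : ℂ) δ, z + l • w ∈ U := by
  have hc : Continuous fun l : ℂ => z + l • w := by fun_prop
  obtain ⟨δ, hδ, h⟩ := Metric.isOpen_iff.1 (hU.preimage hc) 0 (by simpa using hz)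
  exact ⟨δ, hδ, h⟩

theorem integrableOn_exp_neg_div {h : ℂ} (hh : 0 < h.re) :
    IntegrableOn (fun σ : ℝ => Complex.exp (-σ / h)) (Set.Ioi 0) := by
  have h0 : h ≠ 0 := by rintro rfl; simp at hh
  have hp : 0 < (h⁻¹).re := by
    rw [Complex.inv_re]; exact div_pos hh (Complex.normSq_pos.2 h0)
  refine (integrableOn_pow_mul_exp hp 0).congr_fun (fun σ _ => ?_) measurableSet_Ioi
  simp only [pow_zero, one_mul]
  congr 1
  ring

variable {V : Type*} [NormedAddCommGroup V] [NormedSpace ℂ V]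

/-- `φ t a v σ` is jointly continuous, holomorphic in `(v, σ)`, bounded by `C exp (r √a)`, and
`σ ↦ φ t a v σ` is the Borel transform of `h ↦ f t v h * exp (- h a)`. -/
structure BorelFamily (I : Set ℝ) (U : Set V) (S : Set ℂ) (r C : ℝ) (f : ℝ → V → ℂ → ℂ)
    (φ : ℝ → NNReal → V → ℂ → ℂ) : Prop where
  continuousOn : ContinuousOn (fun p : ℝ × NNReal × V × ℂ => φ p.1 p.2.1 p.2.2.1 p.2.2.2)
    (I ×ˢ Set.univ ×ˢ U ×ˢ S)
  line : ∀ t ∈ I, ∀ a, ∀ z ∈ U ×ˢ S, ∀ w,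
    LineDifferentiableAt ℂ (fun z : V × ℂ => φ t a z.1 z.2) z w
  bound : ∀ t ∈ I, ∀ a, ∀ v ∈ U, ∀ σ ∈ S, ‖φ t a v σ‖ ≤ C * Real.exp (r * Real.sqrt a)
  laplace : ∀ t ∈ I, ∀ a : NNReal, ∀ v ∈ U, ∀ h : ℂ, 0 < h.re →
    ∫ σ in Set.Ioi (0 : ℝ), Complex.exp (-σ / h) * φ t a v σ / h =
      f t v h * Complex.exp (-h * (a : ℝ))

namespace BorelFamily

variable {I : Set ℝ} {U : Set V} {S : Set ℂ} {r C : ℝ} {f : ℝ → V → ℂ → ℂ}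
  {φ : ℝ → NNReal → V → ℂ → ℂ}

theorem congr {f' : ℝ → V → ℂ → ℂ} (hφ : BorelFamily I U S r C f φ)
    (hf : ∀ t ∈ I, ∀ v ∈ U, ∀ h : ℂ, 0 < h.re → f t v h = f' t v h) :
    BorelFamily I U S r C f' φ :=
  { hφ with laplace := fun t ht a v hv h hh => by rw [← hf t ht v hv h hh]
                                                  exact hφ.laplace t ht a v hv h hh }

theorem mono {C' : ℝ} (hφ : BorelFamily I U S r C f φ) (hC : C ≤ C') :
    BorelFamily I U S r C' f φ :=
  { hφ with bound := fun t ht a v hv σ hσ => (hφ.bound t ht a v hv σ hσ).trans (by gcongr) }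

theorem continuousOn_right (hφ : BorelFamily I U S r C f φ) (hS : ∀ σ : ℝ, 0 < σ → (σ : ℂ) ∈ S)
    {t : ℝ} (ht : t ∈ I) {v : V} (hv : v ∈ U) :
    ContinuousOn (fun p : ℝ × NNReal => φ t p.2 v p.1) (Set.Ioi 0 ×ˢ Set.univ) := by
  refine hφ.continuousOn.comp (f := fun p : ℝ × NNReal => (t, p.2, v, (p.1 : ℂ))) ?_ ?_
  · fun_prop
  · exact fun p hp => ⟨ht, trivial, hv, hS _ hp.1⟩

theorem continuous_shift (hφ : BorelFamily I U S r C f φ) {t : ℝ} (ht : t ∈ I) {v : V}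
    (hv : v ∈ U) {σ : ℂ} (hσ : σ ∈ S) : Continuous fun a => φ t a v σ :=
  hφ.continuousOn.comp_continuous (f := fun a : NNReal => (t, a, v, σ)) (by fun_prop)
    fun _ => ⟨ht, trivial, hv, hσ⟩

theorem integrableOn (hφ : BorelFamily I U S r C f φ) (hS : ∀ σ : ℝ, 0 < σ → (σ : ℂ) ∈ S)
    {t : ℝ} (ht : t ∈ I) (a : NNReal) {v : V} (hv : v ∈ U) {h : ℂ} (hh : 0 < h.re) :
    IntegrableOn (fun σ : ℝ => Complex.exp (-σ / h) * φ t a v σ / h) (Set.Ioi 0) := by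
  refine ((integrableOn_exp_neg_div hh).mul_bdd (c := C * Real.exp (r * Real.sqrt a)) ?_ ?_).div_const h
  · refine ContinuousOn.aestronglyMeasurable ?_ measurableSet_Ioi
    exact (hφ.continuousOn_right hS ht hv).comp (f := fun σ : ℝ => (σ, a)) (by fun_prop)
      fun σ hσ => ⟨hσ, trivial⟩
  · exact (ae_restrict_mem measurableSet_Ioi).mono fun σ hσ => hφ.bound t ht a v hv _ (hS σ hσ)

/-- Superposition of translates of a family of Borel transforms. -/
theorem integral (hU : IsOpen U) (hSo : IsOpen S) (hS : ∀ σ : ℝ, 0 < σ → (σ : ℂ) ∈ S)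
    (hr : 0 ≤ r) (hC : 0 ≤ C) (hφ : BorelFamily I U S r C f φ)
    {Z : Type*} [MeasurableSpace Z] {ρ : Measure Z} [SFinite ρ] {c : ℝ → V → Z → ℂ}
    {A : ℝ → Z → NNReal} {D : Z → ℝ} (hD : Integrable D ρ)
    (hcm : ∀ t ∈ I, ∀ v ∈ U, AEStronglyMeasurable (c t v) ρ) (hAm : ∀ t ∈ I, Measurable (A t))
    (hb : ∀ᵐ η ∂ρ, ∀ t ∈ I, ∀ v ∈ U, ‖c t v η‖ * Real.exp (r * Real.sqrt (A t η)) ≤ D η)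
    (hcc : ∀ η, ContinuousOn (fun p : ℝ × V => c p.1 p.2 η) (I ×ˢ U))
    (hAc : ∀ η, ContinuousOn (fun t => A t η) I)
    (hcl : ∀ η, ∀ t ∈ I, ∀ v ∈ U, ∀ w, LineDifferentiableAt ℂ (fun v => c t v η) v w) :
    BorelFamily I U S r (C * ∫ η, D η ∂ρ)
      (fun t v h => f t v h * ∫ η, c t v η * Complex.exp (-h * (A t η : ℝ)) ∂ρ)
      (fun t a v σ => ∫ η, c t v η * φ t (a + A t η) v σ ∂ρ) := by
  -- Subadditivity of the square root makes the weight `exp (r √a)` submultiplicative; this is why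
  -- constants multiply when translates are superposed.
  have hE : ∀ a b : NNReal, Real.exp (r * Real.sqrt ((a + b : NNReal) : ℝ)) ≤
      Real.exp (r * Real.sqrt a) * Real.exp (r * Real.sqrt b) := by
    intro a b
    rw [← Real.exp_add, Real.exp_le_exp, ← mul_add]
    push_cast
    gcongr
    rw [Real.sqrt_le_iff]
    refine ⟨by positivity, ?_⟩
    rw [add_sq, Real.sq_sqrt a.coe_nonneg, Real.sq_sqrt b.coe_nonneg]
    have := mul_nonneg (Real.sqrt_nonneg a) (Real.sqrt_nonneg b)
    linarith
  have hbound : ∀ᵐ η ∂ρ, ∀ t ∈ I, ∀ a : NNReal, ∀ v ∈ U, ∀ σ ∈ S,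
      ‖c t v η * φ t (a + A t η) v σ‖ ≤ C * Real.exp (r * Real.sqrt a) * D η := by
    filter_upwards [hb] with η hη t ht a v hv σ hσ
    rw [norm_mul]
    calc ‖c t v η‖ * ‖φ t (a + A t η) v σ‖
        ≤ ‖c t v η‖ * (C * (Real.exp (r * Real.sqrt a) * Real.exp (r * Real.sqrt (A t η)))) := by
          gcongr
          exact (hφ.bound t ht _ v hv σ hσ).trans (by gcongr; exact hE _ _)
      _ = C * Real.exp (r * Real.sqrt a) * (‖c t v η‖ * Real.exp (r * Real.sqrt (A t η))) := by
          ring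
      _ ≤ _ := by gcongr; exact hη t ht v hv
  have hmeas : ∀ t ∈ I, ∀ a : NNReal, ∀ v ∈ U, ∀ σ ∈ S,
      AEStronglyMeasurable (fun η => c t v η * φ t (a + A t η) v σ) ρ := by
    intro t ht a v hv σ hσ
    refine (hcm t ht v hv).mul (Measurable.aestronglyMeasurable ?_)
    exact (hφ.continuous_shift ht hv hσ).measurable.comp (measurable_const.add (hAm t ht))
  refine ⟨?_, ?_, ?_, ?_⟩
  · intro p₀ hp₀
    -- The bound grows with `a`, so a dominating function exists only locally in `a`.
    have hev : ∀ᶠ p in nhdsWithin p₀ (I ×ˢ (Set.univ : Set NNReal) ×ˢ U ×ˢ S),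
        p.2.1 ≤ p₀.2.1 + 1 := by
      refine nhdsWithin_le_nhds (Filter.Tendsto.eventually_le_const (v := p₀.2.1) ?_ ?_)
      · exact lt_add_one _
      · exact (continuous_fst.comp continuous_snd).tendsto p₀
    refine continuousWithinAt_of_dominated
      (bound := fun η => C * Real.exp (r * Real.sqrt ((p₀.2.1 + 1 : NNReal) : ℝ)) * D η) ?_ ?_
      (hD.const_mul _) (Filter.Eventually.of_forall fun η => ?_)
    · filter_upwards [self_mem_nhdsWithin] with p hp
      exact hmeas _ hp.1 _ _ hp.2.2.1 _ hp.2.2.2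
    · filter_upwards [self_mem_nhdsWithin, hev] with p hp hpa
      filter_upwards [hbound, hb] with η hη hη'
      refine (hη _ hp.1 _ _ hp.2.2.1 _ hp.2.2.2).trans ?_
      have : 0 ≤ D η := le_trans (by positivity) (hη' _ hp.1 _ hp.2.2.1)
      have : ((p.2.1 : ℝ)) ≤ ((p₀.2.1 + 1 : NNReal) : ℝ) := by exact_mod_cast hpa
      gcongr
    · refine ContinuousOn.continuousWithinAt (ContinuousOn.mul ?_ ?_) hp₀
      · exact (hcc η).comp (f := fun p : ℝ × NNReal × V × ℂ => (p.1, p.2.2.1)) (by fun_prop)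
          fun p hp => ⟨hp.1, hp.2.2.1⟩
      · refine hφ.continuousOn.comp
          (f := fun p : ℝ × NNReal × V × ℂ => (p.1, p.2.1 + A p.1 η, p.2.2.1, p.2.2.2)) ?_
          fun p hp => ⟨hp.1, trivial, hp.2.2.1, hp.2.2.2⟩
        have := (hAc η).comp (f := fun p : ℝ × NNReal × V × ℂ => p.1)
          (s := I ×ˢ (Set.univ : Set NNReal) ×ˢ U ×ˢ S) (by fun_prop) fun p hp => hp.1
        have h2 : ContinuousOn (fun p : ℝ × NNReal × V × ℂ => A p.1 η)
          (I ×ˢ (Set.univ : Set NNReal) ×ˢ U ×ˢ S) := this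
        refine ContinuousOn.prodMk (by fun_prop) (ContinuousOn.prodMk ?_ (by fun_prop))
        exact ContinuousOn.add (by fun_prop) h2
  · intro t ht a z hz w
    obtain ⟨δ, hδ, hl⟩ := exists_ball_line_mem (hU.prod hSo) hz w
    refine differentiableAt_integral_of_dominated hδ (D := fun η => C * Real.exp (r * Real.sqrt a) * D η)
      (fun l h => hmeas t ht a _ (hl l h).1 _ (hl l h).2) ?_ (hD.const_mul _) ?_
    · filter_upwards [hbound] with η hη l h using hη t ht a _ (hl l h).1 _ (hl l h).2
    · intro η l h
      exact (LineDifferentiableAt.differentiableAt_line (z := z.1) (w := w.1)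
        (f := fun v => c t v η) (hcl η t ht _ (hl l h).1 w.1)).mul
        (LineDifferentiableAt.differentiableAt_line (z := z) (w := w)
          (f := fun z : V × ℂ => φ t (a + A t η) z.1 z.2) (hφ.line t ht _ _ (hl l h) w))
  · intro t ht a v hv σ hσ
    calc _ ≤ ∫ η, C * Real.exp (r * Real.sqrt a) * D η ∂ρ :=
          norm_integral_le_of_norm_le (hD.const_mul _)
            (hbound.mono fun η hη => hη t ht a v hv σ hσ)
      _ = _ := by rw [integral_const_mul]; ring
  · intro t ht a v hv h hh
    let G : ℝ → Z → ℂ := fun σ η => Complex.exp (-σ / h) * (c t v η * φ t (a + A t η) v σ) / h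
    -- Continuity of `φ` is known only over `S`; extension by zero off `σ > 0` gives a measurable
    -- function on the whole product.
    have hΨ : Measurable ((Set.Ioi (0 : ℝ) ×ˢ (Set.univ : Set NNReal)).indicator
        fun p : ℝ × NNReal => φ t p.2 v p.1) :=
      by
        classical
        rw [← Set.piecewise_eq_indicator]
        exact (hφ.continuousOn_right hS ht hv).measurable_piecewise continuousOn_const
          (measurableSet_Ioi.prod MeasurableSet.univ)
    have hGm : AEStronglyMeasurable (Function.uncurry G) ((volume.restrict (Set.Ioi 0)).prod ρ) := by
      have h1 : AEStronglyMeasurable (fun p : ℝ × Z => φ t (a + A t p.2) v p.1)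
          ((volume.restrict (Set.Ioi 0)).prod ρ) := by
        refine ⟨_, (hΨ.comp (measurable_fst.prodMk
          (measurable_const (a := a) |>.add ((hAm t ht).comp measurable_snd)))).stronglyMeasurable, ?_⟩
        have : ∀ᵐ p : ℝ × Z ∂((volume.restrict (Set.Ioi 0)).prod ρ), p.1 ∈ Set.Ioi (0 : ℝ) :=
          Measure.quasiMeasurePreserving_fst.ae (ae_restrict_mem measurableSet_Ioi)
        filter_upwards [this] with p hp
        have hm : (p.1, a + A t p.2) ∈ Set.Ioi (0 : ℝ) ×ˢ (Set.univ : Set NNReal) := ⟨hp, trivial⟩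
        exact (Set.indicator_of_mem hm (fun p : ℝ × NNReal => φ t p.2 v p.1)).symm
      have h2 : AEStronglyMeasurable (fun p : ℝ × Z => Complex.exp (-p.1 / h))
          ((volume.restrict (Set.Ioi 0)).prod ρ) :=
        Measurable.aestronglyMeasurable (by fun_prop)
      simpa [G, Function.uncurry_def, div_eq_mul_inv] using
        (h2.mul ((hcm t ht v hv).comp_snd.mul h1)).mul_const h⁻¹
    have hGi : Integrable (Function.uncurry G) ((volume.restrict (Set.Ioi 0)).prod ρ) := by
      have hdom := ((integrableOn_exp_neg_div hh).norm.mul_prod hD).const_mul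
        (C * Real.exp (r * Real.sqrt a) / ‖h‖)
      refine hdom.mono' hGm ?_
      have h1 : ∀ᵐ p : ℝ × Z ∂((volume.restrict (Set.Ioi 0)).prod ρ), p.1 ∈ Set.Ioi (0 : ℝ) :=
        Measure.quasiMeasurePreserving_fst.ae (ae_restrict_mem measurableSet_Ioi)
      have h2 := Measure.quasiMeasurePreserving_snd (μ := volume.restrict (Set.Ioi (0 : ℝ)))
        (ν := ρ) |>.ae hbound
      filter_upwards [h1, h2] with p hp1 hp2
      simp only [Function.uncurry, G, norm_div, norm_mul _ (c t v p.2 * _)]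
      calc _ ≤ ‖Complex.exp (-p.1 / h)‖ * (C * Real.exp (r * Real.sqrt a) * D p.2) / ‖h‖ := by
            gcongr
            exact hp2 t ht a v hv _ (hS _ hp1)
        _ = _ := by ring
    have e1 : ∀ σ : ℝ, Complex.exp (-σ / h) * (∫ η, c t v η * φ t (a + A t η) v σ ∂ρ) / h =
        ∫ η, G σ η ∂ρ := by
      intro σ
      simp only [G]
      rw [integral_div, integral_const_mul]
    simp_rw [e1]
    -- After Fubini the inner integral is the Laplace formula at the shift `a + A t η`, whose
    -- exponential splits.
    rw [integral_integral_swap hGi]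
    have e2 : ∀ η, ∫ σ in Set.Ioi (0 : ℝ), G σ η =
        f t v h * Complex.exp (-h * (a : ℝ)) * (c t v η * Complex.exp (-h * (A t η : ℝ))) := by
      intro η
      have h1 : ∀ σ : ℝ, G σ η = c t v η * (Complex.exp (-σ / h) * φ t (a + A t η) v σ / h) :=
        fun σ => by simp only [G]; ring
      simp_rw [h1]
      rw [integral_const_mul, hφ.laplace t ht _ v hv h hh]
      push_cast
      rw [mul_add, Complex.exp_add]
      ring
    simp_rw [e2]
    rw [integral_const_mul]
    ring

theorem tsum (hU : IsOpen U) (hSo : IsOpen S) (hS : ∀ σ : ℝ, 0 < σ → (σ : ℂ) ∈ S)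
    {ι : Type*} [Countable ι] {C : ι → ℝ} {f : ι → ℝ → V → ℂ → ℂ} {φ : ι → ℝ → NNReal → V → ℂ → ℂ}
    (hC : Summable C) (hφ : ∀ i, BorelFamily I U S r (C i) (f i) (φ i)) :
    BorelFamily I U S r (∑' i, C i) (fun t v h => ∑' i, f i t v h)
      (fun t a v σ => ∑' i, φ i t a v σ) := by
  refine ⟨?_, ?_, ?_, ?_⟩
  -- Multiplication by `exp (-r √a)` makes the majorants `C i` uniform in `a`, so that the
  -- Weierstrass test applies; the weight is removed afterwards.
  · have h1 : ContinuousOn (fun p : ℝ × NNReal × V × ℂ => ∑' i, φ i p.1 p.2.1 p.2.2.1 p.2.2.2 *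
        (Real.exp (-(r * Real.sqrt p.2.1)) : ℂ)) (I ×ˢ Set.univ ×ˢ U ×ˢ S) := by
      refine continuousOn_tsum (fun i => (hφ i).continuousOn.mul ?_) hC fun i p hp => ?_
      · exact Continuous.continuousOn (by fun_prop)
      · rw [norm_mul, Complex.norm_real, Real.norm_of_nonneg (Real.exp_pos _).le, Real.exp_neg,
          ← div_eq_mul_inv, div_le_iff₀ (Real.exp_pos _)]
        exact (hφ i).bound _ hp.1 _ _ hp.2.2.1 _ hp.2.2.2
    have h2 : Continuous fun p : ℝ × NNReal × V × ℂ => (Real.exp (r * Real.sqrt p.2.1) : ℂ) := by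
      fun_prop
    refine (h1.mul h2.continuousOn).congr fun p _ => ?_
    simp only [tsum_mul_right, Pi.mul_apply]
    rw [mul_assoc, ← Complex.ofReal_mul, ← Real.exp_add, neg_add_cancel]
    simp
  · intro t ht a z hz w
    obtain ⟨δ, hδ, hl⟩ := exists_ball_line_mem (hU.prod hSo) hz w
    refine (Complex.differentiableOn_tsum_of_summable_norm
      (F := fun i (l : ℂ) => φ i t a (z + l • w).1 (z + l • w).2)
      (hC.mul_right (Real.exp (r * Real.sqrt a))) (fun i l h => ?_) Metric.isOpen_ball
      (fun i l h => (hφ i).bound t ht a _ (hl l h).1 _ (hl l h).2)).differentiableAt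
      (ball_mem_nhds 0 hδ)
    exact (LineDifferentiableAt.differentiableAt_line ((hφ i).line t ht a _ (hl l h)
      w)).differentiableWithinAt
  · intro t ht a v hv σ hσ
    rw [← tsum_mul_right]
    exact tsum_of_norm_bounded (hC.mul_right _).hasSum fun i => (hφ i).bound t ht a v hv σ hσ
  · intro t ht a v hv h hh
    have hi := fun i => (hφ i).integrableOn hS ht a hv hh
    have key := hasSum_integral_of_summable_integral_norm hi (by
      refine Summable.of_nonneg_of_le (fun i => integral_nonneg fun σ => norm_nonneg _) (fun i => ?_)
        (hC.mul_right (Real.exp (r * Real.sqrt a) *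
          ∫ σ in Set.Ioi (0 : ℝ), ‖Complex.exp (-σ / h)‖ / ‖h‖))
      rw [← mul_assoc, ← integral_const_mul]
      refine setIntegral_mono_on (hi i).norm
        (((integrableOn_exp_neg_div hh).norm.div_const _).const_mul _) measurableSet_Ioi
        fun σ hσ => ?_
      rw [norm_div, norm_mul, mul_div_assoc', mul_comm ‖_‖]
      gcongr
      exact (hφ i).bound t ht a v hv _ (hS σ hσ))
    have e : ∀ σ : ℝ, ∑' i, Complex.exp (-σ / h) * φ i t a v σ / h =
        Complex.exp (-σ / h) * (∑' i, φ i t a v σ) / h := fun σ => by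
      rw [tsum_div_const, tsum_mul_left]
    simp_rw [e] at key
    rw [← key.tsum_eq, ← tsum_mul_right]
    exact tsum_congr fun i => (hφ i).laplace t ht a v hv h hh

end BorelFamily

theorem cpow_half_sq (z : ℂ) : (z ^ (1 / 2 : ℂ)) ^ 2 = z := by
  rw [← Complex.cpow_mul_nat]
  simp

/-- Removes the square root, and with it the branch cut, from the definition of `parabola`:
membership becomes a strict inequality between continuous functions. -/
theorem im_cpow_half_sq (z : ℂ) : |(z ^ (1 / 2 : ℂ)).im| ^ 2 = (‖z‖ - z.re) / 2 := by
  have h := cpow_half_sq z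
  set w := z ^ (1 / 2 : ℂ)
  rw [← h, norm_pow, Complex.sq_norm, Complex.normSq_apply, sq_abs, pow_two w, Complex.mul_re]
  ring

theorem isOpen_parabola (κ : ℝ) : IsOpen (parabola κ) := by
  simp only [parabola, im_cpow_half_sq]
  exact isOpen_lt (by fun_prop) continuous_const

theorem ofReal_mem_parabola {κ : ℝ} (hκ : 0 < κ) {σ : ℝ} (hσ : 0 < σ) : (σ : ℂ) ∈ parabola κ := by
  simp only [parabola, im_cpow_half_sq, Set.mem_ofPred_eq]
  simpa [abs_of_pos hσ] using hκ

/-- The family of the constant `1`, from which all others are built. The rate `2√κ` combines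
`norm_bess_sq_le` at `w = √a √σ` with `|Im √σ| ≤ √κ`. -/
theorem borelFamily_bess (I : Set ℝ) (U : Set V) (κ : ℝ) :
    BorelFamily I U (parabola κ) (2 * Real.sqrt κ) 1 (fun _ _ _ => 1)
      (fun _ a _ σ => bess ((a : ℝ) * σ)) := by
  refine ⟨?_, ?_, ?_, ?_⟩
  · have := differentiable_bess.continuous
    exact Continuous.continuousOn (this.comp (by fun_prop))
  · intro t _ a z _ w
    have h : Differentiable ℂ fun l : ℂ => bess ((a : ℝ) * (z + l • w).2) :=
      differentiable_bess.comp (by simp only [Prod.snd_add, Prod.smul_snd]; fun_prop)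
    exact h 0
  · intro t _ a v _ σ hσ
    have e : ((a : ℝ) : ℂ) * σ = (Real.sqrt a * σ ^ (1 / 2 : ℂ)) ^ 2 := by
      rw [mul_pow, cpow_half_sq, ← Complex.ofReal_pow, Real.sq_sqrt a.coe_nonneg]
    rw [e, one_mul]
    refine (norm_bess_sq_le _).trans (Real.exp_le_exp.2 ?_)
    rw [Complex.im_ofReal_mul, abs_mul, abs_of_nonneg (Real.sqrt_nonneg _)]
    have : |(σ ^ (1 / 2 : ℂ)).im| ≤ Real.sqrt κ := Real.le_sqrt_of_sq_le (le_of_lt hσ)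
    nlinarith [Real.sqrt_nonneg (a : ℝ), mul_le_mul_of_nonneg_left this (Real.sqrt_nonneg (a : ℝ))]
  · intro t _ a v _ h hh
    rw [integral_exp_mul_bess hh a.coe_nonneg, one_mul]

end BorelFamily

/-! ### Sums over trees -/

section Trees

variable {m : ℕ}

/-- Every tree on `{0, …, m}` is given by a parent function on the vertices other than `0`. -/
theorem exists_parent {g : SimpleGraph (Fin (m + 1))} (hg : g.IsTree) :
    ∃ f : Fin m → Fin (m + 1), Function.Injective (fun j => s(j.succ, f j)) ∧
      ∀ u v, g.Adj u v ↔ ∃ j, s(u, v) = s(j.succ, f j) := by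
  classical
  -- The parent is the neighbour one step closer to the root `0`, the second vertex of a shortest
  -- path. Distances to the root at adjacent vertices of a tree differ by exactly one.
  have hex : ∀ j : Fin m, ∃ k, g.Adj j.succ k ∧ g.dist 0 j.succ = g.dist 0 k + 1 := by
    intro j
    obtain ⟨p, hp, hl⟩ := (hg.connected.exists_path_of_dist j.succ 0)
    cases p with
    | @cons _ k _ h q =>
      refine ⟨k, h, ?_⟩
      rw [SimpleGraph.dist_comm, ← hl, SimpleGraph.Walk.length_cons]
      rcases hg.dist_eq_dist_add_one_of_adj 0 h with h1 | h1
      · rw [SimpleGraph.dist_comm, ← hl, SimpleGraph.Walk.length_cons] at h1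
        exact h1
      · exfalso
        have h2 := SimpleGraph.dist_le q
        rw [SimpleGraph.dist_comm] at h2
        rw [SimpleGraph.dist_comm (v := j.succ), ← hl, SimpleGraph.Walk.length_cons] at h1
        omega
  choose f hadj hdist using hex
  -- Two vertices cannot be parents of each other, as each would be closer to the root than the
  -- other.
  have hinj : Function.Injective (fun j => s(j.succ, f j)) := by
    intro j k h
    rcases Sym2.eq_iff.1 h with ⟨h1, -⟩ | ⟨h1, h2⟩
    · exact Fin.succ_injective _ h1
    · exfalso
      have e1 := hdist j
      have e2 := hdist k
      rw [← h1] at e2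
      rw [h2] at e1
      omega
  refine ⟨f, hinj, fun u v => ⟨fun h => ?_, ?_⟩⟩
  -- The `m` distinct parent edges exhaust the edges of a tree on `m + 1` vertices.
  · have hsub : Finset.univ.image (fun j => s(j.succ, f j)) ⊆ g.edgeFinset := by
      intro e he
      obtain ⟨j, -, rfl⟩ := Finset.mem_image.1 he
      exact SimpleGraph.mem_edgeFinset.2 (hadj j)
    have hcard : g.edgeFinset.card ≤ (Finset.univ.image (fun j => s(j.succ, f j))).card := by
      rw [Finset.card_image_of_injective _ hinj, Finset.card_univ, Fintype.card_fin]
      have := hg.card_edgeFinset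
      rw [Fintype.card_fin] at this
      omega
    have hmem : s(u, v) ∈ g.edgeFinset := SimpleGraph.mem_edgeFinset.2 h
    rw [← Finset.eq_of_subset_of_card_le hsub hcard] at hmem
    obtain ⟨j, -, hj⟩ := Finset.mem_image.1 hmem
    exact ⟨j, hj.symm⟩
  · rintro ⟨j, hj⟩
    rw [← SimpleGraph.mem_edgeSet, hj]
    exact hadj j

open scoped Classical in
-- Each edge is indexed by its child instead of by its ordered pair of endpoints. Every vertex other
-- than the root then contributes its weight once as a child.
theorem prod_edges_eq {g : SimpleGraph (Fin (m + 1))} {f : Fin m → Fin (m + 1)}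
    (hinj : Function.Injective (fun j => s(j.succ, f j)))
    (hf : ∀ u v, g.Adj u v ↔ ∃ j, s(u, v) = s(j.succ, f j)) (b : Fin (m + 1) → ℝ) :
    ∏ p : Fin (m + 1) × Fin (m + 1) with p.1 < p.2 ∧ g.Adj p.1 p.2, b p.1 * b p.2 =
      ∏ j, b j.succ * b (f j) := by
  have hne : ∀ j, j.succ ≠ f j := fun j => ((hf _ _).2 ⟨j, rfl⟩ : g.Adj j.succ (f j)).ne
  let i : Fin m → Fin (m + 1) × Fin (m + 1) := fun j =>
    if j.succ < f j then (j.succ, f j) else (f j, j.succ)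
  have hi : ∀ j, s((i j).1, (i j).2) = s(j.succ, f j) := by
    intro j
    simp only [i]
    split_ifs
    · rfl
    · exact Sym2.eq_swap
  symm
  refine Finset.prod_nbij i (fun j _ => ?_) ?_ ?_ (fun j _ => ?_)
  · rw [Finset.mem_filter]
    refine ⟨Finset.mem_univ _, ?_, (hf _ _).2 ⟨j, hi j⟩⟩
    simp only [i]
    split_ifs with h
    · exact h
    · exact lt_of_le_of_ne (not_lt.1 h) (hne j).symm
  · intro j _ k _ h
    refine hinj ?_
    change s(j.succ, f j) = s(k.succ, f k)
    rw [← hi j, ← hi k, h]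
  · intro p hp
    rw [Finset.mem_coe, Finset.mem_filter] at hp
    obtain ⟨-, hlt, hadj⟩ := hp
    obtain ⟨j, hj⟩ := (hf _ _).1 hadj
    refine ⟨j, Finset.mem_coe.2 (Finset.mem_univ _), ?_⟩
    rcases Sym2.eq_iff.1 hj with ⟨h1, h2⟩ | ⟨h1, h2⟩
    · simp only [i, ← h1, ← h2, if_pos hlt]
    · simp only [i, ← h1, ← h2, if_neg hlt.not_gt]
  · simp only [i]
    split_ifs
    · rfl
    · exact mul_comm _ _

open scoped Classical in
/-- The upper bound in Cayley's formula with weights. -/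
theorem sum_trees_prod_edges_le (b : Fin (m + 1) → ℝ) (hb : ∀ j, 0 ≤ b j) :
    ∑ g : SimpleGraph (Fin (m + 1)) with g.IsTree,
      ∏ p : Fin (m + 1) × Fin (m + 1) with p.1 < p.2 ∧ g.Adj p.1 p.2, b p.1 * b p.2 ≤
      (∏ j : Fin m, b j.succ) * (∑ j, b j) ^ m := by
  have hex : ∀ g : SimpleGraph (Fin (m + 1)), ∃ f : Fin m → Fin (m + 1), g.IsTree →
      (Function.Injective (fun j => s(j.succ, f j)) ∧
        ∀ u v, g.Adj u v ↔ ∃ j, s(u, v) = s(j.succ, f j)) := by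
    intro g
    by_cases hg : g.IsTree
    · obtain ⟨f, h⟩ := exists_parent hg
      exact ⟨f, fun _ => h⟩
    · exact ⟨fun _ => 0, fun h => absurd h hg⟩
  choose F hF using hex
  have e1 : ∑ g : SimpleGraph (Fin (m + 1)) with g.IsTree,
      ∏ p : Fin (m + 1) × Fin (m + 1) with p.1 < p.2 ∧ g.Adj p.1 p.2, b p.1 * b p.2 =
      ∑ g : SimpleGraph (Fin (m + 1)) with g.IsTree,
        (∏ j : Fin m, b j.succ) * ∏ j, b (F g j) := by
    refine Finset.sum_congr rfl fun g hg => ?_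
    have h := hF g (Finset.mem_filter.1 hg).2
    rw [prod_edges_eq h.1 h.2, Finset.prod_mul_distrib]
  rw [e1, ← Finset.mul_sum, Fintype.sum_pow]
  refine mul_le_mul_of_nonneg_left ?_ (Finset.prod_nonneg fun j _ => hb _)
  -- A tree is recovered from its parent function, so the sum over trees is part of the sum over all
  -- functions, which is the expansion of `(∑ b) ^ m`.
  have hinj : Set.InjOn F (Finset.univ.filter fun g : SimpleGraph (Fin (m + 1)) => g.IsTree) := by
    intro g hg g' hg' h
    have h1 := (hF g (by simpa using hg)).2
    have h2 := (hF g' (by simpa using hg')).2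
    ext u v
    rw [h1, h2, h]
  rw [← Finset.sum_image (f := fun f : Fin m → Fin (m + 1) => ∏ j, b (f j)) hinj]
  exact Finset.sum_le_univ_sum_of_nonneg fun f => Finset.prod_nonneg fun j _ => hb _

end Trees

/-! ### The volume of the ordered simplex -/

section Simplex

theorem measurableSet_orderedSimplex (m : ℕ) : MeasurableSet (orderedSimplex m) := by
  have : orderedSimplex m = (⋂ i : Fin m, ⋂ j : Fin m, ⋂ _ : i < j, {s : Fin m → ℝ | s i < s j}) ∩
      ⋂ j : Fin m, {s | s j ∈ Set.Ioo (0 : ℝ) 1} := by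
    ext s
    simp only [orderedSimplex, StrictMono, Set.mem_ofPred_eq, Set.mem_inter_iff, Set.mem_iInter]
  rw [this]
  refine MeasurableSet.inter ?_ ?_
  · exact MeasurableSet.iInter fun i => MeasurableSet.iInter fun j => MeasurableSet.iInter fun _ =>
      measurableSet_lt (measurable_pi_apply i) (measurable_pi_apply j)
  · exact MeasurableSet.iInter fun j => measurable_pi_apply j measurableSet_Ioo

/-- The `m!` images of the simplex under coordinate permutations are disjoint, have equal volume and
lie in the unit cube. -/
theorem volume_orderedSimplex_le (m : ℕ) :
    volume (orderedSimplex m) ≤ ENNReal.ofReal (1 / m.factorial) := by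
  let P : Equiv.Perm (Fin m) → Set (Fin m → ℝ) := fun π =>
    (fun s : Fin m → ℝ => s ∘ π) ⁻¹' orderedSimplex m
  have hmp : ∀ π : Equiv.Perm (Fin m),
      MeasurePreserving (fun s : Fin m → ℝ => s ∘ π) volume volume := by
    intro π
    have := volume_measurePreserving_piCongrLeft (fun _ : Fin m => ℝ) π.symm
    convert this using 1
    ext s j
    have := Equiv.piCongrLeft_apply_apply (fun _ : Fin m => ℝ) π.symm s (π j)
    rw [MeasurableEquiv.coe_piCongrLeft]
    simpa using this.symm
  have hvol : ∀ π, volume (P π) = volume (orderedSimplex m) := fun π =>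
    (hmp π).measure_preimage (measurableSet_orderedSimplex m).nullMeasurableSet
  have hdisj : Pairwise (Function.onFun Disjoint P) := by
    intro π π' hne
    refine Set.disjoint_left.2 fun s hs hs' => hne ?_
    have h1 : StrictMono (s ∘ π) := hs.1
    have h2 : StrictMono (s ∘ π') := hs'.1
    have hsinj : Function.Injective s := by
      intro a b hab
      have := h1.injective (a₁ := π.symm a) (a₂ := π.symm b) (by simpa using hab)
      exact π.symm.injective this
    -- If one point is sorted by two permutations, their quotient is an increasing bijection of `Fin
    -- m`, hence the identity.
    have h3 : StrictMono (π'.symm ∘ π) := by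
      intro a b hab
      have := h1 hab
      rw [← h2.lt_iff_lt]
      simpa using this
    have h4 : ∀ a, (π'.symm ∘ π) a = a := by
      let e : Fin m ≃o Fin m := StrictMono.orderIsoOfSurjective _ h3
        (π'.symm.surjective.comp π.surjective)
      intro a
      have : e = OrderIso.refl _ := Subsingleton.elim _ _
      exact DFunLike.congr_fun this a
    ext a
    have := h4 a
    simp only [Function.comp, Equiv.symm_apply_eq] at this
    rw [this]
  have hsub : (⋃ π, P π) ⊆ Set.pi Set.univ fun _ => Set.Ioo (0 : ℝ) 1 := by
    intro s hs
    obtain ⟨π, hπ⟩ := Set.mem_iUnion.1 hs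
    intro j _
    have := hπ.2 (π.symm j)
    simpa using this
  have h1 : volume (⋃ π, P π) ≤ 1 := by
    refine (measure_mono hsub).trans ?_
    rw [volume_pi_pi]
    simp
  rw [measure_iUnion hdisj fun π => (hmp π).measurable (measurableSet_orderedSimplex m)] at h1
  simp only [hvol, tsum_fintype, Finset.sum_const, Finset.card_univ, Fintype.card_perm,
    Fintype.card_fin, nsmul_eq_mul] at h1
  rw [one_div, ENNReal.ofReal_inv_of_pos (by positivity), ENNReal.ofReal_natCast,
    ENNReal.le_inv_iff_mul_le, mul_comm]
  exact h1

end Simplex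

/-! ### Hyperbolic estimates -/

section Hyperbolic

theorem sinh_le_mul_cosh {b : ℝ} (hb : 0 ≤ b) : Real.sinh b ≤ b * Real.cosh b := by
  have hd : ∀ x, HasDerivAt (fun x => x * Real.cosh x - Real.sinh x) (x * Real.sinh x) x := by
    intro x
    have := ((hasDerivAt_id x).mul (Real.hasDerivAt_cosh x)).sub (Real.hasDerivAt_sinh x)
    exact this.congr_deriv (by simp)
  have hm : MonotoneOn (fun x => x * Real.cosh x - Real.sinh x) (Set.Ici 0) := by
    refine monotoneOn_of_deriv_nonneg (convex_Ici 0) (by fun_prop) (by fun_prop) fun x hx => ?_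
    rw [interior_Ici] at hx
    rw [(hd x).deriv]
    exact mul_nonneg (le_of_lt hx) (Real.sinh_nonneg_iff.2 (le_of_lt hx))
  have := hm Set.self_mem_Ici hb hb
  simpa using this

/-- Convexity of `sinh` on the half-line. It bounds the coefficients of `q_t` by the weights `s` and
`1 - s`. -/
theorem sinh_mul_le {a s : ℝ} (ha : 0 ≤ a) (hs : 0 ≤ s) (hs1 : s ≤ 1) :
    Real.sinh (a * s) ≤ s * Real.sinh a := by
  have hd : ∀ x, HasDerivAt (fun x => s * Real.sinh x - Real.sinh (x * s))
      (s * Real.cosh x - Real.cosh (x * s) * s) x := by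
    intro x
    exact ((Real.hasDerivAt_sinh x).const_mul s).sub (hasDerivAt_mul_const s).sinh
  have hm : MonotoneOn (fun x => s * Real.sinh x - Real.sinh (x * s)) (Set.Ici 0) := by
    refine monotoneOn_of_deriv_nonneg (convex_Ici 0) (by fun_prop) (by fun_prop) fun x hx => ?_
    rw [interior_Ici] at hx
    have hx' : 0 < x := hx
    rw [(hd x).deriv, mul_comm, ← sub_mul]
    refine mul_nonneg (sub_nonneg.2 ?_) hs
    rw [Real.cosh_le_cosh, abs_of_nonneg (mul_nonneg hx'.le hs), abs_of_pos hx']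
    exact mul_le_of_le_one_right hx'.le hs1
  have := hm Set.self_mem_Ici ha ha
  simpa using this

/-- The Green function of the harmonic oscillator. -/
def green (w t s s' : ℝ) : ℝ :=
  Real.sinh (w * t * s) * Real.sinh (w * t * (1 - s')) / (w * Real.sinh (w * t))

theorem green_nonneg {w t s s' : ℝ} (hw : 0 < w) (ht : 0 < t) (hs : 0 ≤ s) (hs' : s' ≤ 1) :
    0 ≤ green w t s s' := by
  have h := mul_pos hw ht
  have h1 : 0 ≤ Real.sinh (w * t * s) := Real.sinh_nonneg_iff.2 (by positivity)
  have h2 : 0 ≤ Real.sinh (w * t * (1 - s')) :=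
    Real.sinh_nonneg_iff.2 (mul_nonneg h.le (by linarith))
  have h3 : 0 < Real.sinh (w * t) := Real.sinh_pos_iff.2 h
  unfold green
  positivity

/-- The product-to-sum formula bounds the diagonal value by `(cosh (wt) - 1) / 2` over `w sinh
(wt)`; half-angle formulas and `sinh b ≤ b cosh b` at `b = wt/2` finish. The constant `t / 4` is the
maximum of the limiting kernel `t s (1 - s)` as `w → 0`. -/
theorem green_le {w t s s' : ℝ} (hw : 0 < w) (ht : 0 < t) (hs : 0 ≤ s) (hss : s ≤ s') :
    green w t s s' ≤ t / 4 := by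
  have h := mul_pos hw ht
  have h3 : 0 < Real.sinh (w * t) := Real.sinh_pos_iff.2 h
  rw [green, div_le_iff₀ (by positivity)]
  have h1 : 0 ≤ Real.sinh (w * t * s) := Real.sinh_nonneg_iff.2 (by positivity)
  have h4 : Real.sinh (w * t * (1 - s')) ≤ Real.sinh (w * t * (1 - s)) :=
    Real.sinh_le_sinh.2 (by gcongr)
  refine (mul_le_mul_of_nonneg_left h4 h1).trans ?_
  have h5 : 2 * (Real.sinh (w * t * s) * Real.sinh (w * t * (1 - s))) =
      Real.cosh (w * t) - Real.cosh (w * t * s - w * t * (1 - s)) := by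
    have e : Real.cosh (w * t) = Real.cosh (w * t * s + w * t * (1 - s)) := by congr 1; ring
    rw [e, Real.cosh_add, Real.cosh_sub]
    ring
  have h6 := Real.one_le_cosh (w * t * s - w * t * (1 - s))
  have h7 : 2 * (Real.cosh (w * t) - 1) ≤ w * t * Real.sinh (w * t) := by
    set b := w * t / 2 with hb
    have e : w * t = 2 * b := by rw [hb]; ring
    rw [e, Real.cosh_two_mul, Real.sinh_two_mul, Real.cosh_sq]
    have hb0 : 0 ≤ b := by positivity
    have := mul_le_mul_of_nonneg_left (sinh_le_mul_cosh hb0) (Real.sinh_nonneg_iff.2 hb0)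
    nlinarith
  nlinarith

end Hyperbolic

/-! ### Positivity of quadratic forms by the layer cake formula -/

section LayerCake

variable {ι : Type*} [Fintype ι]

/-- Layer cake: `X i` is the integral over `u` in `(0, M]` of the indicator of `u ≤ X i`, so the
weighted sum is an integral of nonnegative layers. -/
theorem sum_nonneg_of_layers {M : ℝ} {X c : ι → ℝ} (hX : ∀ i, 0 ≤ X i) (hXM : ∀ i, X i ≤ M)
    (h : ∀ u, 0 < u → 0 ≤ ∑ i, if u ≤ X i then c i else 0) : 0 ≤ ∑ i, X i * c i := by
  have e : ∀ i, X i * c i = ∫ u in Set.Ioc 0 M, if u ≤ X i then c i else 0 := by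
    intro i
    have h1 : (fun u => if u ≤ X i then c i else 0) = (Set.Iic (X i)).indicator fun _ => c i := by
      ext u
      simp [Set.indicator_apply]
    rw [h1, integral_indicator measurableSet_Iic, Measure.restrict_restrict measurableSet_Iic,
      setIntegral_const]
    have h2 : Set.Iic (X i) ∩ Set.Ioc 0 M = Set.Ioc 0 (X i) := by
      ext u
      simp only [Set.mem_inter_iff, Set.mem_Iic, Set.mem_Ioc]
      have := hXM i
      grind
    rw [h2, Real.volume_real_Ioc_of_le (hX i)]
    simp
  simp_rw [e]
  rw [← integral_finsetSum]
  · exact setIntegral_nonneg measurableSet_Ioc fun u hu => h u hu.1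
  · intro i _
    refine Measure.integrableOn_of_bounded (M := |c i|) (by simp) ?_ ?_
    · exact (Measurable.ite measurableSet_Iic measurable_const
        measurable_const).aestronglyMeasurable
    · refine Filter.Eventually.of_forall fun u => ?_
      split_ifs <;> simp

/-- The sum splits into one square for each class. -/
theorem sum_same_class_nonneg {κ : Type*} [Finite κ] [DecidableEq κ] (π : ι → κ) (b : ι → ℝ) :
    0 ≤ ∑ p : ι × ι, if π p.1 = π p.2 then b p.1 * b p.2 else 0 := by
  have := Fintype.ofFinite κ
  have e : ∑ p : ι × ι, (if π p.1 = π p.2 then b p.1 * b p.2 else 0) =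
      ∑ c : κ, (∑ j, if π j = c then b j else 0) ^ 2 := by
    simp_rw [pow_two, Finset.sum_mul_sum]
    rw [Finset.sum_comm, Fintype.sum_prod_type]
    refine Finset.sum_congr rfl fun i _ => ?_
    rw [Finset.sum_comm]
    refine Finset.sum_congr rfl fun j _ => ?_
    rw [Finset.sum_eq_single (π j)]
    · by_cases h : π i = π j <;> simp [h]
    · intro c _ hc
      simp [hc.symm]
    · simp
  rw [e]
  positivity

end LayerCake

/-! ### The interpolation parameters -/

section MinOnPath

variable {m : ℕ} {g : SimpleGraph (Fin m)}

/-- The path in a tree is unique, so the infimum is over one finite set; `j ≠ k` makes this set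
nonempty and excludes the default value of `sInf`. -/
theorem le_minOnPath_iff (hg : g.IsTree) {j k : Fin m} (hjk : j ≠ k) {p : g.Walk j k}
    (hp : p.IsPath) (θ : g.edgeSet → ℝ) (u : ℝ) :
    u ≤ minOnPath g θ j k ↔ ∀ e : g.edgeSet, (e : Sym2 (Fin m)) ∈ p.edges → u ≤ θ e := by
  have hset : {r | ∃ p : g.Walk j k, p.IsPath ∧ ∃ e : g.edgeSet, (e : Sym2 (Fin m)) ∈ p.edges ∧
      θ e = r} = θ '' {e | (e : Sym2 (Fin m)) ∈ p.edges} := by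
    ext r
    constructor
    · rintro ⟨q, hq, e, he, rfl⟩
      rw [(hg.existsUnique_path j k).unique hq hp] at he
      exact ⟨e, he, rfl⟩
    · rintro ⟨e, he, rfl⟩
      exact ⟨p, hp, e, he, rfl⟩
  have hne : (θ '' {e | (e : Sym2 (Fin m)) ∈ p.edges}).Nonempty := by
    cases p with
    | nil => exact absurd rfl hjk
    | @cons _ l _ h q => exact ⟨_, ⟨⟨s(j, l), h⟩, by simp, rfl⟩⟩
  rw [minOnPath, hset, le_csInf_iff (Set.toFinite _).bddBelow hne]
  constructor
  · exact fun h e he => h _ ⟨e, he, rfl⟩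
  · rintro h _ ⟨e, he, rfl⟩
    exact h e he

theorem measurable_minOnPath (hg : g.IsTree) {j k : Fin m} (hjk : j ≠ k) :
    Measurable fun θ : g.edgeSet → ℝ => minOnPath g θ j k := by
  obtain ⟨p, hp, -⟩ := hg.existsUnique_path j k
  refine measurable_of_Ici fun u => ?_
  have : (fun θ : g.edgeSet → ℝ => minOnPath g θ j k) ⁻¹' Set.Ici u =
      ⋂ e : g.edgeSet, ⋂ _ : (e : Sym2 (Fin m)) ∈ p.edges, {θ | u ≤ θ e} := by
    ext θ
    simp only [Set.mem_preimage, Set.mem_Ici, le_minOnPath_iff hg hjk hp, Set.mem_iInter,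
      Set.mem_ofPred_eq]
  rw [this]
  exact MeasurableSet.iInter fun e => MeasurableSet.iInter fun _ =>
    measurableSet_le measurable_const (measurable_pi_apply e)

theorem minOnPath_mem_Icc (hg : g.IsTree) {j k : Fin m} (hjk : j ≠ k) {θ : g.edgeSet → ℝ}
    (hθ : θ ∈ Set.Icc (0 : g.edgeSet → ℝ) 1) : minOnPath g θ j k ∈ Set.Icc (0 : ℝ) 1 := by
  obtain ⟨p, hp, -⟩ := hg.existsUnique_path j k
  refine ⟨(le_minOnPath_iff hg hjk hp θ 0).2 fun e _ => hθ.1 e, ?_⟩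
  have h := (le_minOnPath_iff hg hjk hp θ _).1 le_rfl
  cases p with
  | nil => exact absurd rfl hjk
  | @cons _ l _ h1 q => exact (h ⟨s(j, l), h1⟩ (by simp)).trans (hθ.2 _)

/-- The matrix `θ_{j,k,g}` completed by `1` on the diagonal. -/
def thetaMatrix (g : SimpleGraph (Fin m)) (θ : g.edgeSet → ℝ) (j k : Fin m) : ℝ :=
  if j = k then 1 else minOnPath g θ j k

/-- The subgraph of the edges with parameter at least `u`. -/
def levelGraph (g : SimpleGraph (Fin m)) (θ : g.edgeSet → ℝ) (u : ℝ) : SimpleGraph (Fin m) :=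
  SimpleGraph.fromEdgeSet {e | ∃ h : e ∈ g.edgeSet, u ≤ θ ⟨e, h⟩}

theorem levelGraph_le (θ : g.edgeSet → ℝ) (u : ℝ) : levelGraph g θ u ≤ g := by
  intro j k h
  rw [levelGraph, SimpleGraph.fromEdgeSet_adj] at h
  exact h.1.1

/-- The superlevel sets of `θ_{j,k,g}` are equivalence relations (lying in one component after
deleting the edges below `u`). This is the source of positivity. -/
theorem le_minOnPath_iff_reachable (hg : g.IsTree) {j k : Fin m} (hjk : j ≠ k)
    (θ : g.edgeSet → ℝ) (u : ℝ) :
    u ≤ minOnPath g θ j k ↔ (levelGraph g θ u).Reachable j k := by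
  have hedge : ∀ e : g.edgeSet, (e : Sym2 (Fin m)) ∈ (levelGraph g θ u).edgeSet ↔ u ≤ θ e := by
    intro e
    rw [levelGraph, SimpleGraph.edgeSet_fromEdgeSet, Set.mem_sdiff]
    constructor
    · exact fun h => h.1.2
    · exact fun h => ⟨⟨e.2, h⟩, g.not_isDiag_of_mem_edgeSet e.2⟩
  constructor
  · intro h
    obtain ⟨p, hp, -⟩ := hg.existsUnique_path j k
    rw [le_minOnPath_iff hg hjk hp] at h
    refine ⟨p.transfer (levelGraph g θ u) fun e he => ?_⟩
    exact (hedge ⟨e, p.edges_subset_edgeSet he⟩).2 (h _ he)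
  · intro h
    obtain ⟨q, hq⟩ := h.exists_isPath
    have hp : (q.mapLe (levelGraph_le θ u)).IsPath :=
      (SimpleGraph.Walk.isPath_mapLe _).2 hq
    rw [le_minOnPath_iff hg hjk hp]
    intro e he
    rw [SimpleGraph.Walk.edges_mapLe_eq_edges] at he
    exact (hedge e).1 (q.edges_subset_edgeSet he)

theorem thetaMatrix_mem_Icc (hg : g.IsTree) {θ : g.edgeSet → ℝ}
    (hθ : θ ∈ Set.Icc (0 : g.edgeSet → ℝ) 1) (j k : Fin m) :
    thetaMatrix g θ j k ∈ Set.Icc (0 : ℝ) 1 := by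
  rw [thetaMatrix]
  split_ifs with h
  · simp
  · exact minOnPath_mem_Icc hg h hθ

theorem minOnPath_comm (θ : g.edgeSet → ℝ) (j k : Fin m) :
    minOnPath g θ j k = minOnPath g θ k j := by
  have key : ∀ j k : Fin m, {r | ∃ p : g.Walk j k, p.IsPath ∧ ∃ e : g.edgeSet,
      (e : Sym2 (Fin m)) ∈ p.edges ∧ θ e = r} ⊆ {r | ∃ p : g.Walk k j, p.IsPath ∧
        ∃ e : g.edgeSet, (e : Sym2 (Fin m)) ∈ p.edges ∧ θ e = r} := by
    rintro j k r ⟨p, hp, e, he, rfl⟩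
    exact ⟨p.reverse, hp.reverse, e, by simpa using he, rfl⟩
  rw [minOnPath, minOnPath, (key j k).antisymm (key k j)]

theorem thetaMatrix_comm (θ : g.edgeSet → ℝ) (j k : Fin m) :
    thetaMatrix g θ j k = thetaMatrix g θ k j := by
  rw [thetaMatrix, thetaMatrix, minOnPath_comm]
  simp only [eq_comm]

theorem thetaMatrix_form_nonneg (hg : g.IsTree) {θ : g.edgeSet → ℝ}
    (hθ : θ ∈ Set.Icc (0 : g.edgeSet → ℝ) 1) (b : Fin m → ℝ) :
    0 ≤ ∑ p : Fin m × Fin m, thetaMatrix g θ p.1 p.2 * (b p.1 * b p.2) := by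
  classical
  refine sum_nonneg_of_layers (M := 1) (fun p => (thetaMatrix_mem_Icc hg hθ _ _).1)
    (fun p => (thetaMatrix_mem_Icc hg hθ _ _).2) fun u hu => ?_
  by_cases hu1 : u ≤ 1
  -- For `u ≤ 1` the layer, diagonal included, is the relation of lying in the same component of
  -- `levelGraph g θ u`; above `1` it is empty.
  · refine (sum_same_class_nonneg (levelGraph g θ u).connectedComponentMk b).trans_eq ?_
    refine Finset.sum_congr rfl fun p _ => ?_
    refine if_congr ?_ rfl rfl
    rw [SimpleGraph.ConnectedComponent.eq, thetaMatrix]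
    split_ifs with h
    · simp [h, hu1]
    · exact (le_minOnPath_iff_reachable hg h θ u).symm
  · refine Finset.sum_nonneg fun p _ => ?_
    rw [if_neg fun h => hu1 (h.trans (thetaMatrix_mem_Icc hg hθ _ _).2)]

/-- The Schur product of `thetaMatrix` with the kernel `min (G j) (G k)`. -/
theorem thetaMatrix_min_form_nonneg (hg : g.IsTree) {θ : g.edgeSet → ℝ}
    (hθ : θ ∈ Set.Icc (0 : g.edgeSet → ℝ) 1) {G : Fin m → ℝ} (hG : ∀ j, 0 ≤ G j)
    (b : Fin m → ℝ) :
    0 ≤ ∑ p : Fin m × Fin m,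
      min (G p.1) (G p.2) * (thetaMatrix g θ p.1 p.2 * (b p.1 * b p.2)) := by
  refine sum_nonneg_of_layers (M := ∑ j, G j) (fun p => le_min (hG _) (hG _))
    (fun p => (min_le_left _ _).trans (Finset.single_le_sum (fun j _ => hG j) (Finset.mem_univ _)))
    fun u _ => ?_
  -- The layer of `min (G j) (G k)` at height `u` only truncates `b` to the indices with `u ≤ G j`.
  refine (thetaMatrix_form_nonneg hg hθ fun j => if u ≤ G j then b j else 0).trans_eq ?_
  refine Finset.sum_congr rfl fun p _ => ?_
  by_cases h1 : u ≤ G p.1 <;> by_cases h2 : u ≤ G p.2 <;> simp [h1, h2]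

end MinOnPath

/-! ### Estimates of the ingredients of the tree expansion -/

section Estimates

variable {ν m : ℕ}

theorem sum_pairs_eq {F : Fin m × Fin m → ℝ} (hF : ∀ p, F p.swap = F p) :
    ∑ p, F p = (∑ j, F (j, j)) + 2 * ∑ p : Fin m × Fin m with p.1 < p.2, F p := by
  have h1 : ∑ p : Fin m × Fin m with p.2 < p.1, F p =
      ∑ p : Fin m × Fin m with p.1 < p.2, F p := by
    refine Finset.sum_nbij' Prod.swap Prod.swap ?_ ?_ ?_ ?_ ?_ <;> simp [hF]
  have h2 : ∑ p : Fin m × Fin m with p.1 = p.2, F p = ∑ j, F (j, j) := by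
    refine Finset.sum_nbij' Prod.fst (fun j => (j, j)) ?_ ?_ ?_ ?_ ?_ <;> aesop
  have h3 : ∀ p, F p = (if p.1 = p.2 then F p else 0) + ((if p.1 < p.2 then F p else 0) +
      (if p.2 < p.1 then F p else 0)) := by
    intro p
    rcases lt_trichotomy p.1 p.2 with h | h | h
    · simp [h, h.ne, h.not_gt]
    · simp [h]
    · simp [h, h.ne', h.not_gt]
  rw [Finset.sum_congr rfl fun p _ => h3 p, Finset.sum_add_distrib, Finset.sum_add_distrib,
    ← Finset.sum_filter, ← Finset.sum_filter, ← Finset.sum_filter, h1, h2]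
  ring

theorem omegaForm_eq (ω : Fin ν → ℝ) (t : ℝ) (g : SimpleGraph (Fin m)) (θ : g.edgeSet → ℝ)
    {s : Fin m → ℝ} (hs : StrictMono s) (ξ : Fin m → EuclideanSpace ℝ (Fin ν)) :
    omegaForm ω t g θ s ξ = ∑ p : Fin m × Fin m, thetaMatrix g θ p.1 p.2 *
      ∑ υ, green (ω υ) t (min (s p.1) (s p.2)) (max (s p.1) (s p.2)) * (ξ p.1 υ * ξ p.2 υ) := by
  rw [sum_pairs_eq, omegaForm]
  · congr 1
    · refine Finset.sum_congr rfl fun j _ => ?_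
      simp only [thetaMatrix, if_true, one_mul, min_self, max_self, green, pow_two]
    · congr 1
      refine Finset.sum_congr rfl fun p hp => ?_
      have hlt := (Finset.mem_filter.1 hp).2
      rw [thetaMatrix, if_neg hlt.ne, min_eq_left (hs hlt).le, max_eq_right (hs hlt).le]
      simp only [green, mul_assoc]
  · intro p
    simp only [Prod.fst_swap, Prod.snd_swap]
    rw [thetaMatrix_comm, min_comm, max_comm]
    simp only [mul_comm]

/-- The ratio `sinh (wt(1-s)) / sinh (wts)` decreases in `s`, so the Green function is a `min`
kernel in this ratio times a rank one kernel, as `thetaMatrix_min_form_nonneg` requires. -/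
theorem green_min_max {w t : ℝ} (hw : 0 < w) (ht : 0 < t) {s s' : ℝ}
    (hs : s ∈ Set.Ioo (0 : ℝ) 1) (hs' : s' ∈ Set.Ioo (0 : ℝ) 1) :
    green w t (min s s') (max s s') =
      min (Real.sinh (w * t * (1 - s)) / Real.sinh (w * t * s))
        (Real.sinh (w * t * (1 - s')) / Real.sinh (w * t * s')) *
      (Real.sinh (w * t * s) * Real.sinh (w * t * s') / (w * Real.sinh (w * t))) := by
  have h := mul_pos hw ht
  have key : ∀ s s' : ℝ, s ∈ Set.Ioo (0 : ℝ) 1 → s' ∈ Set.Ioo (0 : ℝ) 1 → s ≤ s' →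
      Real.sinh (w * t * (1 - s')) / Real.sinh (w * t * s') ≤
        Real.sinh (w * t * (1 - s)) / Real.sinh (w * t * s) := by
    intro s s' hs hs' hss
    have h1 : 0 < Real.sinh (w * t * s) := Real.sinh_pos_iff.2 (mul_pos h hs.1)
    refine div_le_div₀ ?_ ?_ h1 ?_
    · exact Real.sinh_nonneg_iff.2 (mul_nonneg h.le (by linarith [hs.2]))
    · exact Real.sinh_le_sinh.2 (by gcongr)
    · exact Real.sinh_le_sinh.2 (by gcongr)
  have h1 : 0 < Real.sinh (w * t * s) := Real.sinh_pos_iff.2 (mul_pos h hs.1)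
  have h1' : 0 < Real.sinh (w * t * s') := Real.sinh_pos_iff.2 (mul_pos h hs'.1)
  have h3 : 0 < Real.sinh (w * t) := Real.sinh_pos_iff.2 h
  rcases le_total s s' with hss | hss
  · rw [min_eq_left hss, max_eq_right hss, min_eq_right (key s s' hs hs' hss), green]
    field_simp
  · rw [min_eq_right hss, max_eq_left hss, min_eq_left (key s' s hs' hs hss), green]
    field_simp

/-- Coordinate by coordinate in `υ`, the form is the Schur product of `thetaMatrix` with a `min`
kernel, the rank one factor being absorbed into the vector. -/
theorem omegaForm_nonneg {ω : Fin ν → ℝ} (hω : ∀ υ, 0 < ω υ) {t : ℝ} (ht : 0 < t)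
    {g : SimpleGraph (Fin m)} (hg : g.IsTree) {θ : g.edgeSet → ℝ}
    (hθ : θ ∈ Set.Icc (0 : g.edgeSet → ℝ) 1) {s : Fin m → ℝ} (hs : s ∈ orderedSimplex m)
    (ξ : Fin m → EuclideanSpace ℝ (Fin ν)) : 0 ≤ omegaForm ω t g θ s ξ := by
  rw [omegaForm_eq ω t g θ hs.1]
  simp_rw [Finset.mul_sum]
  rw [Finset.sum_comm]
  refine Finset.sum_nonneg fun υ _ => ?_
  have hw := hω υ
  have h := mul_pos hw ht
  have h3 : 0 < Real.sinh (ω υ * t) := Real.sinh_pos_iff.2 h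
  have key := thetaMatrix_min_form_nonneg hg hθ
    (G := fun j => Real.sinh (ω υ * t * (1 - s j)) / Real.sinh (ω υ * t * s j))
    (fun j => div_nonneg
      (Real.sinh_nonneg_iff.2 (mul_nonneg h.le (by linarith [(hs.2 j).2])))
      (Real.sinh_nonneg_iff.2 (mul_nonneg h.le (hs.2 j).1.le)))
    (fun j => Real.sinh (ω υ * t * s j) * ξ j υ)
  have := mul_nonneg (inv_nonneg.2 (mul_pos hw h3).le) key
  rw [Finset.mul_sum] at this
  refine this.trans_eq (Finset.sum_congr rfl fun p _ => ?_)
  rw [green_min_max hw ht (hs.2 _) (hs.2 _)]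
  ring

theorem abs_sum_green_le {c : Fin ν → ℝ} {B : ℝ} (hB : ∀ υ, |c υ| ≤ B)
    (ξ η : EuclideanSpace ℝ (Fin ν)) : |∑ υ, c υ * (ξ υ * η υ)| ≤ B * (‖ξ‖ * ‖η‖) := by
  -- In dimension zero nothing forces `B ≥ 0`, but both sides vanish.
  rcases isEmpty_or_nonempty (Fin ν) with hν | ⟨⟨υ₀⟩⟩
  · simp [Subsingleton.elim ξ 0]
  have hB0 : 0 ≤ B := (abs_nonneg _).trans (hB υ₀)
  calc |∑ υ, c υ * (ξ υ * η υ)| ≤ ∑ υ, |c υ * (ξ υ * η υ)| := Finset.abs_sum_le_sum_abs _ _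
    _ ≤ ∑ υ, B * (|ξ υ| * |η υ|) := by
        refine Finset.sum_le_sum fun υ _ => ?_
        rw [abs_mul, abs_mul]
        exact mul_le_mul_of_nonneg_right (hB υ) (by positivity)
    _ = B * ∑ υ, |ξ υ| * |η υ| := by rw [Finset.mul_sum]
    _ ≤ B * (‖ξ‖ * ‖η‖) := by
        gcongr
        rw [EuclideanSpace.norm_eq, EuclideanSpace.norm_eq]
        exact Real.sum_mul_le_sqrt_mul_sqrt _ _ _

theorem omegaForm_le {ω : Fin ν → ℝ} (hω : ∀ υ, 0 < ω υ) {t : ℝ} (ht : 0 < t)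
    {g : SimpleGraph (Fin m)} (hg : g.IsTree) {θ : g.edgeSet → ℝ}
    (hθ : θ ∈ Set.Icc (0 : g.edgeSet → ℝ) 1) {s : Fin m → ℝ} (hs : s ∈ orderedSimplex m)
    (ξ : Fin m → EuclideanSpace ℝ (Fin ν)) :
    omegaForm ω t g θ s ξ ≤ t / 4 * (∑ j, ‖ξ j‖) ^ 2 := by
  rw [omegaForm_eq ω t g θ hs.1, pow_two, Finset.sum_mul_sum, ← Fintype.sum_prod_type',
    Finset.mul_sum]
  refine Finset.sum_le_sum fun p _ => ?_
  have hp := thetaMatrix_mem_Icc hg hθ p.1 p.2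
  have h1 := abs_sum_green_le (c := fun υ => green (ω υ) t (min (s p.1) (s p.2))
    (max (s p.1) (s p.2))) (B := t / 4) (fun υ => by
      have h0 : 0 ≤ min (s p.1) (s p.2) := le_min (hs.2 _).1.le (hs.2 _).1.le
      rw [abs_of_nonneg (green_nonneg (hω υ) ht h0 (max_le (hs.2 _).2.le (hs.2 _).2.le))]
      exact green_le (hω υ) ht h0 min_le_max) (ξ p.1) (ξ p.2)
  refine (le_abs_self _).trans ?_
  rw [abs_mul, abs_of_nonneg hp.1]
  exact (mul_le_of_le_one_left (abs_nonneg _) hp.2).trans h1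

open scoped Classical in
-- The constant `1 / 4` is split evenly between the endpoints, so that the bound is a product of
-- vertex weights fit for `sum_trees_prod_edges_le`.
theorem abs_upsilon_le {ω : Fin ν → ℝ} (hω : ∀ υ, 0 < ω υ) {t : ℝ} (ht : 0 < t)
    (g : SimpleGraph (Fin m)) {s : Fin m → ℝ} (hs : s ∈ orderedSimplex m)
    (ξ : Fin m → EuclideanSpace ℝ (Fin ν)) :
    |upsilon ω t g s ξ| ≤
      ∏ p : Fin m × Fin m with p.1 < p.2 ∧ g.Adj p.1 p.2, (‖ξ p.1‖ / 2) * (‖ξ p.2‖ / 2) := by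
  rw [upsilon, Finset.abs_prod]
  refine Finset.prod_le_prod (fun p _ => abs_nonneg _) fun p hp => ?_
  have hlt := hs.1 (Finset.mem_filter.1 hp).2.1
  have h1 := abs_sum_green_le (c := fun υ => green (ω υ) t (s p.1) (s p.2) / t) (B := 1 / 4)
    (fun υ => by
      rw [abs_of_nonneg (div_nonneg (green_nonneg (hω υ) ht (hs.2 _).1.le (hs.2 _).2.le) ht.le),
        div_le_iff₀ ht]
      exact (green_le (hω υ) ht (hs.2 _).1.le hlt.le).trans_eq (by ring)) (ξ p.1) (ξ p.2)
  calc _ = |∑ υ, green (ω υ) t (s p.1) (s p.2) / t * (ξ p.1 υ * ξ p.2 υ)| := by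
        congr 1
        refine Finset.sum_congr rfl fun υ _ => ?_
        have := (hω υ).ne'
        have : Real.sinh (ω υ * t) ≠ 0 := (Real.sinh_pos_iff.2 (mul_pos (hω υ) ht)).ne'
        rw [green]
        field_simp
    _ ≤ _ := h1
    _ = _ := by ring

theorem abs_sum_mul_le (a b : EuclideanSpace ℝ (Fin ν)) : ∑ υ, |a υ| * |b υ| ≤ ‖a‖ * ‖b‖ := by
  rw [EuclideanSpace.norm_eq, EuclideanSpace.norm_eq]
  exact Real.sum_mul_le_sqrt_mul_sqrt _ _ _

/-- The coefficients of `x` and `y` in `q_t(s)` are real and at most `s` and `1 - s`, so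
Cauchy–Schwarz and the tube condition give at most `|ξ_j| / 2` for each `j`. -/
theorem abs_im_qDot_le {ω : Fin ν → ℝ} (hω : ∀ υ, 0 < ω υ) {t : ℝ} (ht : 0 < t)
    {x y : EuclideanSpace ℂ (Fin ν)} (hx : x ∈ tube ν (1 / 2)) (hy : y ∈ tube ν (1 / 2))
    {s : Fin m → ℝ} (hs : ∀ j, s j ∈ Set.Ioo (0 : ℝ) 1)
    (ξ : Fin m → EuclideanSpace ℝ (Fin ν)) :
    |(qDot ω t x y s ξ).im| ≤ (∑ j, ‖ξ j‖) / 2 := by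
  have hx' : ‖(WithLp.toLp 2 (fun υ => (x υ).im) : EuclideanSpace ℝ (Fin ν))‖ < 1 / 2 := hx
  have hy' : ‖(WithLp.toLp 2 (fun υ => (y υ).im) : EuclideanSpace ℝ (Fin ν))‖ < 1 / 2 := hy
  rw [qDot, Complex.im_sum, Finset.sum_div]
  refine (Finset.abs_sum_le_sum_abs _ _).trans (Finset.sum_le_sum fun j _ => ?_)
  rw [Complex.im_sum]
  refine (Finset.abs_sum_le_sum_abs _ _).trans ?_
  have hsj := hs j
  calc _ ≤ ∑ υ, (s j * (|(x υ).im| * |ξ j υ|) + (1 - s j) * (|(y υ).im| * |ξ j υ|)) := by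
        refine Finset.sum_le_sum fun υ _ => ?_
        have h := mul_pos (hω υ) ht
        have h3 : 0 < Real.sinh (ω υ * t) := Real.sinh_pos_iff.2 h
        have e : (qPath ω t x y (s j) υ * (ξ j υ : ℂ)).im =
            (Real.sinh (ω υ * t * s j) / Real.sinh (ω υ * t) * (x υ).im +
              Real.sinh (ω υ * t * (1 - s j)) / Real.sinh (ω υ * t) * (y υ).im) * ξ j υ := by
          rw [qPath, Complex.im_mul_ofReal, ← Complex.ofReal_one, ← Complex.ofReal_div,
            Complex.im_ofReal_mul, Complex.add_im, Complex.im_ofReal_mul, Complex.im_ofReal_mul]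
          ring
        have a1 : |Real.sinh (ω υ * t * s j) / Real.sinh (ω υ * t)| ≤ s j := by
          rw [abs_of_nonneg (div_nonneg (Real.sinh_nonneg_iff.2 (mul_nonneg h.le hsj.1.le)) h3.le),
            div_le_iff₀ h3]
          exact sinh_mul_le h.le hsj.1.le hsj.2.le
        have a2 : |Real.sinh (ω υ * t * (1 - s j)) / Real.sinh (ω υ * t)| ≤ 1 - s j := by
          rw [abs_of_nonneg (div_nonneg (Real.sinh_nonneg_iff.2
            (mul_nonneg h.le (by linarith [hsj.2]))) h3.le), div_le_iff₀ h3]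
          exact sinh_mul_le h.le (by linarith [hsj.2]) (by linarith [hsj.1])
        rw [e, abs_mul]
        calc _ ≤ (s j * |(x υ).im| + (1 - s j) * |(y υ).im|) * |ξ j υ| := by
              refine mul_le_mul_of_nonneg_right ((abs_add_le _ _).trans ?_) (abs_nonneg _)
              rw [abs_mul, abs_mul]
              gcongr
          _ = _ := by ring
    _ = s j * ∑ υ, |(x υ).im| * |ξ j υ| + (1 - s j) * ∑ υ, |(y υ).im| * |ξ j υ| := by
        rw [Finset.sum_add_distrib, Finset.mul_sum, Finset.mul_sum]
    _ ≤ s j * (1 / 2 * ‖ξ j‖) + (1 - s j) * (1 / 2 * ‖ξ j‖) := by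
        have h1 : 0 ≤ 1 - s j := by linarith [hsj.2]
        have b1 := (abs_sum_mul_le (WithLp.toLp 2 fun υ => (x υ).im) (ξ j)).trans
          (mul_le_mul_of_nonneg_right hx'.le (norm_nonneg _))
        have b2 := (abs_sum_mul_le (WithLp.toLp 2 fun υ => (y υ).im) (ξ j)).trans
          (mul_le_mul_of_nonneg_right hy'.le (norm_nonneg _))
        have := hsj.1.le
        gcongr
    _ = ‖ξ j‖ / 2 := by ring

theorem isOpen_tube (ν : ℕ) (R : ℝ) : IsOpen (tube ν R) := by
  refine isOpen_lt (continuous_norm.comp ?_) continuous_const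
  refine (PiLp.continuous_toLp 2 _).comp (continuous_pi fun υ => ?_)
  exact Complex.continuous_im.comp (EuclideanSpace.proj (𝕜 := ℂ) υ).continuous

end Estimates

/-! ### The polar decomposition -/

section Polar

variable {α : Type*} [MeasurableSpace α]

theorem measurable_polar (μ : ComplexMeasure α) : Measurable (polar μ) := by
  refine measurable_of_re_im (𝕜 := ℂ) ?_ ?_
  · exact SignedMeasure.measurable_rnDeriv _ _
  · exact SignedMeasure.measurable_rnDeriv _ _

/-- For a fixed `c`, comparing integrals over all measurable sets gives `Re (c * polar) ≤ |c|`
almost everywhere. A countable dense set of `c` yields one null set, and `c` is then taken to be the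
conjugate of the density. -/
theorem norm_polar_le_one (μ : ComplexMeasure α) [IsFiniteMeasure μ.variation] :
    ∀ᵐ a ∂μ.variation, ‖polar μ a‖ ≤ 1 := by
  have hint : Integrable (polar μ) μ.variation := μ.integrable_rnDeriv μ.variation
  have hset : ∀ i, MeasurableSet i → ‖∫ a in i, polar μ a ∂μ.variation‖ ≤ μ.variation.real i := by
    intro i hi
    rw [← withDensityᵥ_apply hint hi, withDensity_polar]
    exact VectorMeasure.norm_measure_le_variation
  have key : ∀ c : ℂ, ∀ᵐ a ∂μ.variation, (c * polar μ a).re ≤ ‖c‖ := by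
    intro c
    refine ae_le_of_forall_setIntegral_le (f := fun a => (c * polar μ a).re) (g := fun _ => ‖c‖)
      (hint.const_mul c).re (integrable_const _) fun i hi _ => ?_
    have h1 : ∫ a in i, (c * polar μ a).re ∂μ.variation =
        (∫ a in i, c * polar μ a ∂μ.variation).re := by
      simpa using integral_re (𝕜 := ℂ) ((hint.const_mul c).integrableOn (s := i))
    rw [h1, integral_const_mul, setIntegral_const, smul_eq_mul]
    calc _ ≤ ‖c * ∫ a in i, polar μ a ∂μ.variation‖ := Complex.re_le_norm _
      _ ≤ ‖c‖ * μ.variation.real i := by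
          rw [norm_mul]
          exact mul_le_mul_of_nonneg_left (hset i hi) (norm_nonneg _)
      _ = _ := mul_comm _ _
  have hall := ae_all_iff.2 fun n : ℕ => key (TopologicalSpace.denseSeq ℂ n)
  filter_upwards [hall] with a ha
  have hc : ∀ c : ℂ, (c * polar μ a).re ≤ ‖c‖ := by
    intro c
    have hcl : IsClosed {c : ℂ | (c * polar μ a).re ≤ ‖c‖} :=
      isClosed_le (Complex.continuous_re.comp (by fun_prop)) continuous_norm
    exact (TopologicalSpace.denseRange_denseSeq ℂ).induction_on
      (p := fun c : ℂ => (c * polar μ a).re ≤ ‖c‖) c hcl ha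
  have h := hc (starRingEnd ℂ (polar μ a))
  rw [mul_comm, Complex.mul_conj, Complex.norm_conj, Complex.ofReal_re,
    Complex.normSq_eq_norm_sq] at h
  nlinarith [norm_nonneg (polar μ a)]

end Polar

/-! ### The integrals attached to a tree -/

section TreeIntegral

variable {ν m : ℕ}

/-- The space of the integration variables `(s, ξ, θ, ϑ)` attached to a tree. -/
abbrev TreeSpace (ν : ℕ) {m : ℕ} (g : SimpleGraph (Fin m)) : Type :=
  (Fin m → ℝ) × (Fin m → EuclideanSpace ℝ (Fin ν)) × (g.edgeSet → ℝ) × ℝ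

open scoped Classical in
/-- The product measure on `TreeSpace`. -/
def treeMeasure (μ : ComplexMeasure (EuclideanSpace ℝ (Fin ν))) (g : SimpleGraph (Fin m)) :
    Measure (TreeSpace ν g) :=
  (volume.restrict (orderedSimplex m)).prod ((Measure.pi fun _ : Fin m => μ.variation).prod
    ((volume.restrict (Set.Icc 0 1)).prod (volume.restrict (Set.Icc 0 1))))

instance (μ : ComplexMeasure (EuclideanSpace ℝ (Fin ν))) [IsFiniteMeasure μ.variation]
    (g : SimpleGraph (Fin m)) : SFinite (treeMeasure μ g) := by
  unfold treeMeasure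
  exact Measure.prod.instSFinite

/-- The amplitude of the integrand of `wTerm`. -/
def treeAmplitude (ω : Fin ν → ℝ) (μ : ComplexMeasure (EuclideanSpace ℝ (Fin ν)))
    (g : SimpleGraph (Fin (m + 1))) (t : ℝ)
    (v : EuclideanSpace ℂ (Fin ν) × EuclideanSpace ℂ (Fin ν)) (η : TreeSpace ν g) : ℂ :=
  2 ^ m * (-1) ^ (m + 1) * (t : ℂ) ^ (2 * m + 1) *
    ((upsilon ω t g η.1 η.2.1 : ℂ) * (omegaForm ω t g η.2.2.1 η.1 η.2.1 : ℂ) *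
      Complex.exp (Complex.I * qDot ω t v.1 v.2 η.1 η.2.1)) * ∏ j, polar μ (η.2.1 j)

/-- The coefficient of `- h` in the exponent of the integrand of `wTerm`. -/
def treePhase (ω : Fin ν → ℝ) (g : SimpleGraph (Fin m)) (t : ℝ) (η : TreeSpace ν g) : NNReal :=
  (η.2.2.2 * omegaForm ω t g η.2.2.1 η.1 η.2.1).toNNReal

open scoped Classical in
/-- The bound for `treeAmplitude`, as a function of `ξ`. -/
def treeBound (T : ℝ) (g : SimpleGraph (Fin (m + 1)))
    (ξ : Fin (m + 1) → EuclideanSpace ℝ (Fin ν)) : ℝ :=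
  2 ^ m * T ^ (2 * m + 1) *
    (∏ p : Fin (m + 1) × Fin (m + 1) with p.1 < p.2 ∧ g.Adj p.1 p.2,
      (‖ξ p.1‖ / 2) * (‖ξ p.2‖ / 2)) *
    (T / 4 * (∑ j, ‖ξ j‖) ^ 2) * Real.exp ((∑ j, ‖ξ j‖) / 2) * Real.exp (∑ j, ‖ξ j‖)

theorem measurable_omegaForm (ω : Fin ν → ℝ) (t : ℝ) {g : SimpleGraph (Fin m)} (hg : g.IsTree) :
    Measurable fun η : TreeSpace ν g => omegaForm ω t g η.2.2.1 η.1 η.2.1 := by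
  unfold omegaForm
  refine Measurable.add (by fun_prop) (Measurable.const_mul (Finset.measurable_sum _
    fun p hp => Measurable.mul ?_ (by fun_prop)) _)
  have hlt := (Finset.mem_filter.1 hp).2
  exact (measurable_minOnPath hg hlt.ne).comp
    (measurable_fst.comp (measurable_snd.comp measurable_snd))

theorem measurable_treePhase (ω : Fin ν → ℝ) (t : ℝ) {g : SimpleGraph (Fin m)} (hg : g.IsTree) :
    Measurable (treePhase ω g t) :=
  ((measurable_snd.comp (measurable_snd.comp measurable_snd)).mul
    (measurable_omegaForm ω t hg)).real_toNNReal

theorem measurable_treeAmplitude (ω : Fin ν → ℝ) (μ : ComplexMeasure (EuclideanSpace ℝ (Fin ν)))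
    {g : SimpleGraph (Fin (m + 1))} (hg : g.IsTree) (t : ℝ)
    (v : EuclideanSpace ℂ (Fin ν) × EuclideanSpace ℂ (Fin ν)) :
    Measurable (treeAmplitude ω μ g t v) := by
  unfold treeAmplitude
  refine Measurable.mul (Measurable.const_mul (Measurable.mul (Measurable.mul ?_ ?_) ?_) _) ?_
  · refine Complex.measurable_ofReal.comp ?_
    unfold upsilon
    exact Finset.measurable_prod _ fun p _ => by fun_prop
  · exact Complex.measurable_ofReal.comp (measurable_omegaForm ω t hg)
  · refine Complex.measurable_exp.comp (Measurable.const_mul ?_ _)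
    unfold qDot qPath
    fun_prop
  · refine Finset.measurable_prod _ fun j _ => (measurable_polar μ).comp ?_
    fun_prop

theorem continuousOn_omegaForm {ω : Fin ν → ℝ} (hω : ∀ υ, 0 < ω υ) (g : SimpleGraph (Fin m))
    (θ : g.edgeSet → ℝ) (s : Fin m → ℝ) (ξ : Fin m → EuclideanSpace ℝ (Fin ν)) :
    ContinuousOn (fun t => omegaForm ω t g θ s ξ) (Set.Ioi 0) := by
  have h : ∀ υ, ∀ t ∈ Set.Ioi (0 : ℝ), ω υ * Real.sinh (ω υ * t) ≠ 0 := fun υ t ht =>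
    (mul_pos (hω υ) (Real.sinh_pos_iff.2 (mul_pos (hω υ) ht))).ne'
  unfold omegaForm
  refine ContinuousOn.add ?_ (ContinuousOn.mul continuousOn_const ?_)
  · exact continuousOn_finsetSum _ fun j _ => continuousOn_finsetSum _ fun υ _ =>
      (ContinuousOn.div (by fun_prop) (by fun_prop) (h υ)).mul continuousOn_const
  · exact continuousOn_finsetSum _ fun p _ => continuousOn_const.mul
      (continuousOn_finsetSum _ fun υ _ => ((ContinuousOn.div (by fun_prop) (by fun_prop)
        (h υ)).mul continuousOn_const).mul continuousOn_const)

theorem continuousOn_upsilon {ω : Fin ν → ℝ} (hω : ∀ υ, 0 < ω υ) (g : SimpleGraph (Fin m))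
    (s : Fin m → ℝ) (ξ : Fin m → EuclideanSpace ℝ (Fin ν)) :
    ContinuousOn (fun t => upsilon ω t g s ξ) (Set.Ioi 0) := by
  have h : ∀ υ, ∀ t ∈ Set.Ioi (0 : ℝ), ω υ * t * Real.sinh (ω υ * t) ≠ 0 := fun υ t ht =>
    (mul_pos (mul_pos (hω υ) ht) (Real.sinh_pos_iff.2 (mul_pos (hω υ) ht))).ne'
  unfold upsilon
  exact continuousOn_finsetProd _ fun p _ =>
      (continuousOn_finsetSum _ fun υ _ => ((ContinuousOn.div (by fun_prop) (by fun_prop)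
        (h υ)).mul continuousOn_const).mul continuousOn_const)

theorem continuousOn_qDot {ω : Fin ν → ℝ} (hω : ∀ υ, 0 < ω υ)
    (s : Fin m → ℝ) (ξ : Fin m → EuclideanSpace ℝ (Fin ν)) :
    ContinuousOn (fun p : ℝ × EuclideanSpace ℂ (Fin ν) × EuclideanSpace ℂ (Fin ν) =>
      qDot ω p.1 p.2.1 p.2.2 s ξ) (Set.Ioi 0 ×ˢ Set.univ) := by
  have h : ∀ υ, ∀ p ∈ Set.Ioi (0 : ℝ) ×ˢ
      (Set.univ : Set (EuclideanSpace ℂ (Fin ν) × EuclideanSpace ℂ (Fin ν))),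
      ((Real.sinh (ω υ * p.1) : ℝ) : ℂ) ≠ 0 := fun υ p hp =>
    Complex.ofReal_ne_zero.2 (Real.sinh_pos_iff.2 (mul_pos (hω υ) hp.1)).ne'
  unfold qDot qPath
  exact continuousOn_finsetSum _ fun j _ => continuousOn_finsetSum _ fun υ _ =>
    ((ContinuousOn.div (by fun_prop) (by fun_prop) (h υ)).mul (by fun_prop)).mul continuousOn_const

theorem continuousOn_treePhase {ω : Fin ν → ℝ} (hω : ∀ υ, 0 < ω υ) (g : SimpleGraph (Fin m))
    (η : TreeSpace ν g) : ContinuousOn (fun t => treePhase ω g t η) (Set.Ioi 0) :=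
  continuous_real_toNNReal.comp_continuousOn
    (continuousOn_const.mul (continuousOn_omegaForm hω g _ _ _))

theorem continuousOn_treeAmplitude {ω : Fin ν → ℝ} (hω : ∀ υ, 0 < ω υ)
    (μ : ComplexMeasure (EuclideanSpace ℝ (Fin ν))) (g : SimpleGraph (Fin (m + 1)))
    (η : TreeSpace ν g) :
    ContinuousOn (fun p : ℝ × EuclideanSpace ℂ (Fin ν) × EuclideanSpace ℂ (Fin ν) =>
      treeAmplitude ω μ g p.1 p.2 η) (Set.Ioi 0 ×ˢ Set.univ) := by
  have hfst : Set.MapsTo (fun p : ℝ × EuclideanSpace ℂ (Fin ν) × EuclideanSpace ℂ (Fin ν) => p.1)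
    (Set.Ioi 0 ×ˢ Set.univ) (Set.Ioi 0) := fun p hp => hp.1
  unfold treeAmplitude
  refine ContinuousOn.mul (ContinuousOn.mul (by fun_prop)
    (ContinuousOn.mul (ContinuousOn.mul ?_ ?_) ?_)) continuousOn_const
  · exact Complex.continuous_ofReal.comp_continuousOn
      ((continuousOn_upsilon hω g _ _).comp continuousOn_fst hfst)
  · exact Complex.continuous_ofReal.comp_continuousOn
      ((continuousOn_omegaForm hω g _ _ _).comp continuousOn_fst hfst)
  · exact Complex.continuous_exp.comp_continuousOn
      (continuousOn_const.mul (continuousOn_qDot hω _ _))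

theorem differentiable_treeAmplitude (ω : Fin ν → ℝ)
    (μ : ComplexMeasure (EuclideanSpace ℝ (Fin ν))) (g : SimpleGraph (Fin (m + 1))) (t : ℝ)
    (η : TreeSpace ν g) : Differentiable ℂ fun v => treeAmplitude ω μ g t v η := by
  have h : Differentiable ℂ fun v : EuclideanSpace ℂ (Fin ν) × EuclideanSpace ℂ (Fin ν) =>
      qDot ω t v.1 v.2 η.1 η.2.1 := by
    unfold qDot qPath
    fun_prop
  unfold treeAmplitude
  fun_prop

theorem continuous_treeBound (T : ℝ) (g : SimpleGraph (Fin (m + 1))) :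
    Continuous (treeBound (ν := ν) T g) := by
  unfold treeBound
  fun_prop

theorem treeBound_nonneg {T : ℝ} (hT : 0 < T) (g : SimpleGraph (Fin (m + 1)))
    (ξ : Fin (m + 1) → EuclideanSpace ℝ (Fin ν)) : 0 ≤ treeBound T g ξ := by
  unfold treeBound
  positivity

theorem treePhase_eq {ω : Fin ν → ℝ} (hω : ∀ υ, 0 < ω υ) {t : ℝ} (ht : 0 < t)
    {g : SimpleGraph (Fin m)} (hg : g.IsTree) {η : TreeSpace ν g}
    (hs : η.1 ∈ orderedSimplex m) (hθ : η.2.2.1 ∈ Set.Icc (0 : g.edgeSet → ℝ) 1)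
    (hϑ : η.2.2.2 ∈ Set.Icc (0 : ℝ) 1) :
    (treePhase ω g t η : ℝ) = η.2.2.2 * omegaForm ω t g η.2.2.1 η.1 η.2.1 :=
  Real.coe_toNNReal _ (mul_nonneg hϑ.1 (omegaForm_nonneg hω ht hg hθ hs _))

theorem norm_treeAmplitude_le {ω : Fin ν → ℝ} (hω : ∀ υ, 0 < ω υ)
    {μ : ComplexMeasure (EuclideanSpace ℝ (Fin ν))} {T t : ℝ} (ht : t ∈ Set.Ioo 0 T)
    {g : SimpleGraph (Fin (m + 1))} (hg : g.IsTree)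
    {v : EuclideanSpace ℂ (Fin ν) × EuclideanSpace ℂ (Fin ν)}
    (hv : v ∈ tube ν (1 / 2) ×ˢ tube ν (1 / 2)) {η : TreeSpace ν g}
    (hs : η.1 ∈ orderedSimplex (m + 1)) (hθ : η.2.2.1 ∈ Set.Icc (0 : g.edgeSet → ℝ) 1)
    (hϑ : η.2.2.2 ∈ Set.Icc (0 : ℝ) 1) (hξ : ∀ j, ‖polar μ (η.2.1 j)‖ ≤ 1) :
    ‖treeAmplitude ω μ g t v η‖ *
      Real.exp (2 * Real.sqrt (1 / T) * Real.sqrt (treePhase ω g t η)) ≤ treeBound T g η.2.1 := by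
  classical
  have hT : 0 < T := ht.1.trans ht.2
  have hΩ0 := omegaForm_nonneg hω ht.1 hg hθ hs η.2.1
  have hΩ : omegaForm ω t g η.2.2.1 η.1 η.2.1 ≤ T / 4 * (∑ j, ‖η.2.1 j‖) ^ 2 :=
    (omegaForm_le hω ht.1 hg hθ hs η.2.1).trans (by gcongr; exact ht.2.le)
  have hS : 0 ≤ ∑ j, ‖η.2.1 j‖ := Finset.sum_nonneg fun j _ => norm_nonneg _
  -- The choice `κ = 1 / T` cancels the factor `T` in `Ω ≤ (T/4) S²`, leaving growth `exp S`
  -- whatever the number of vertices.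
  have h1 : 2 * Real.sqrt (1 / T) * Real.sqrt (treePhase ω g t η) ≤ ∑ j, ‖η.2.1 j‖ := by
    rw [treePhase_eq hω ht.1 hg hs hθ hϑ, mul_assoc, ← Real.sqrt_mul (by positivity)]
    have h2 : Real.sqrt (1 / T * (η.2.2.2 * omegaForm ω t g η.2.2.1 η.1 η.2.1)) ≤
        (∑ j, ‖η.2.1 j‖) / 2 := by
      rw [Real.sqrt_le_iff]
      refine ⟨by positivity, ?_⟩
      calc _ ≤ 1 / T * (1 * (T / 4 * (∑ j, ‖η.2.1 j‖) ^ 2)) := by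
            gcongr
            exact hϑ.2
        _ = _ := by field_simp; ring
    linarith
  have h3 : ‖Complex.exp (Complex.I * qDot ω t v.1 v.2 η.1 η.2.1)‖ ≤
      Real.exp ((∑ j, ‖η.2.1 j‖) / 2) := by
    rw [Complex.norm_exp, Real.exp_le_exp]
    have := abs_im_qDot_le hω ht.1 hv.1 hv.2 hs.2 η.2.1
    simp only [Complex.mul_re, Complex.I_re, Complex.I_im, zero_mul, one_mul, zero_sub]
    exact (neg_le_abs _).trans this
  have h4 : ∏ j, ‖polar μ (η.2.1 j)‖ ≤ 1 := Finset.prod_le_one (fun j _ => norm_nonneg _)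
    fun j _ => hξ j
  have h5 := abs_upsilon_le hω ht.1 g hs η.2.1
  rw [treeAmplitude, treeBound]
  simp only [norm_mul, norm_pow, norm_neg, norm_one, one_pow, mul_one, Complex.norm_ofNat,
    Complex.norm_real, norm_prod, Real.norm_eq_abs, abs_of_pos ht.1, abs_of_nonneg hΩ0]
  have ht' := ht.1.le
  calc 2 ^ m * t ^ (2 * m + 1) * (|upsilon ω t g η.1 η.2.1| * omegaForm ω t g η.2.2.1 η.1 η.2.1 *
        ‖Complex.exp (Complex.I * qDot ω t v.1 v.2 η.1 η.2.1)‖) * (∏ j, ‖polar μ (η.2.1 j)‖) *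
        Real.exp (2 * Real.sqrt (1 / T) * Real.sqrt (treePhase ω g t η)) ≤
      2 ^ m * T ^ (2 * m + 1) * ((∏ p : Fin (m + 1) × Fin (m + 1) with p.1 < p.2 ∧ g.Adj p.1 p.2,
        (‖η.2.1 p.1‖ / 2) * (‖η.2.1 p.2‖ / 2)) * (T / 4 * (∑ j, ‖η.2.1 j‖) ^ 2) *
        Real.exp ((∑ j, ‖η.2.1 j‖) / 2)) * 1 * Real.exp (∑ j, ‖η.2.1 j‖) := by
        have h6 := (abs_nonneg _).trans h5
        have h7 := ht.2.le
        gcongr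
    _ = _ := by
        rw [mul_one]
        simp only [mul_assoc]

end TreeIntegral

/-! ### The sum over trees and the Borel transform of `wTerm` -/

section TreeSum

variable {ν m : ℕ}

theorem integral_prod_four {α β γ δ : Type*} [MeasurableSpace α] [MeasurableSpace β]
    [MeasurableSpace γ] [MeasurableSpace δ] {μ₁ : Measure α} {μ₂ : Measure β} {μ₃ : Measure γ}
    {μ₄ : Measure δ} [SFinite μ₁] [SFinite μ₂] [SFinite μ₃] [SFinite μ₄]
    {F : α × β × γ × δ → ℂ} (hF : Integrable F (μ₁.prod (μ₂.prod (μ₃.prod μ₄)))) :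
    ∫ η, F η ∂(μ₁.prod (μ₂.prod (μ₃.prod μ₄))) =
      ∫ a, ∫ b, ∫ c, ∫ d, F (a, b, c, d) ∂μ₄ ∂μ₃ ∂μ₂ ∂μ₁ := by
  rw [integral_prod _ hF]
  refine integral_congr_ae (hF.prod_right_ae.mono fun a ha => ?_)
  simp only
  rw [integral_prod _ ha]
  refine integral_congr_ae (ha.prod_right_ae.mono fun b hb => ?_)
  simp only
  rw [integral_prod _ hb]

theorem ae_prod_and {α β : Type*} [MeasurableSpace α] [MeasurableSpace β] {μ : Measure α}
    {ρ : Measure β} [SFinite ρ] {p : α → Prop} {q : β → Prop} (hp : ∀ᵐ a ∂μ, p a)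
    (hq : ∀ᵐ b ∂ρ, q b) : ∀ᵐ z ∂μ.prod ρ, p z.1 ∧ q z.2 := by
  filter_upwards [Measure.quasiMeasurePreserving_fst.ae hp,
    Measure.quasiMeasurePreserving_snd.ae hq] with z h1 h2 using ⟨h1, h2⟩

theorem ae_treeMeasure (μ : ComplexMeasure (EuclideanSpace ℝ (Fin ν)))
    [IsFiniteMeasure μ.variation] (g : SimpleGraph (Fin m)) :
    ∀ᵐ η ∂treeMeasure μ g, η.1 ∈ orderedSimplex m ∧
      η.2.2.1 ∈ Set.Icc (0 : g.edgeSet → ℝ) 1 ∧ η.2.2.2 ∈ Set.Icc (0 : ℝ) 1 ∧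
      ∀ j, ‖polar μ (η.2.1 j)‖ ≤ 1 := by
  classical
  have h1 : ∀ᵐ s ∂(volume : Measure (Fin m → ℝ)).restrict (orderedSimplex m),
      s ∈ orderedSimplex m := ae_restrict_mem (measurableSet_orderedSimplex m)
  have h2 : ∀ᵐ ξ ∂Measure.pi fun _ : Fin m => μ.variation, ∀ j, ‖polar μ (ξ j)‖ ≤ 1 :=
    ae_all_iff.2 fun j => (Measure.quasiMeasurePreserving_eval (fun _ : Fin m => μ.variation) j).ae
      (norm_polar_le_one μ)
  have h3 : ∀ᵐ θ ∂(volume : Measure (g.edgeSet → ℝ)).restrict (Set.Icc 0 1),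
      θ ∈ Set.Icc (0 : g.edgeSet → ℝ) 1 := ae_restrict_mem measurableSet_Icc
  have h4 : ∀ᵐ u ∂(volume : Measure ℝ).restrict (Set.Icc 0 1), u ∈ Set.Icc (0 : ℝ) 1 :=
    ae_restrict_mem measurableSet_Icc
  filter_upwards [ae_prod_and h1 (ae_prod_and h2 (ae_prod_and h3 h4))] with η hη
  exact ⟨hη.1, hη.2.2.1, hη.2.2.2, hη.2.1⟩

theorem volume_restrict_cube_prod (ι : Type*) [Fintype ι] :
    (((volume : Measure (ι → ℝ)).restrict (Set.Icc 0 1)).prod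
      ((volume : Measure ℝ).restrict (Set.Icc 0 1))) Set.univ = 1 := by
  rw [← Set.univ_prod_univ, Measure.prod_prod, Measure.restrict_apply_univ,
    Measure.restrict_apply_univ, Real.volume_Icc_pi]
  simp

/-- The dominating function depends on `ξ` only: the cube of `(θ, ϑ)` has mass one and `s`
contributes the volume of the simplex. -/
theorem integral_treeMeasure_comp (μ : ComplexMeasure (EuclideanSpace ℝ (Fin ν)))
    [IsFiniteMeasure μ.variation] (g : SimpleGraph (Fin m))
    (D : (Fin m → EuclideanSpace ℝ (Fin ν)) → ℝ) :
    ∫ η, D η.2.1 ∂treeMeasure μ g =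
      volume.real (orderedSimplex m) * ∫ ξ, D ξ ∂Measure.pi fun _ => μ.variation := by
  classical
  refine (integral_fun_snd (fun η : (Fin m → EuclideanSpace ℝ (Fin ν)) × (g.edgeSet → ℝ) × ℝ =>
    D η.1)).trans ?_
  rw [integral_fun_fst D, measureReal_restrict_apply_univ, smul_eq_mul,
    measureReal_def (Measure.prod _ _), volume_restrict_cube_prod, ENNReal.toReal_one, one_smul]

theorem integrable_treeMeasure_comp (μ : ComplexMeasure (EuclideanSpace ℝ (Fin ν)))
    [IsFiniteMeasure μ.variation] (g : SimpleGraph (Fin m))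
    {D : (Fin m → EuclideanSpace ℝ (Fin ν)) → ℝ}
    (hD : Integrable D (Measure.pi fun _ => μ.variation)) :
    Integrable (fun η => D η.2.1) (treeMeasure μ g) := by
  classical
  have : IsFiniteMeasure ((volume : Measure (Fin m → ℝ)).restrict (orderedSimplex m)) :=
    ⟨by rw [Measure.restrict_apply_univ]
        exact (volume_orderedSimplex_le m).trans_lt ENNReal.ofReal_lt_top⟩
  have : IsFiniteMeasure (((volume : Measure (g.edgeSet → ℝ)).restrict (Set.Icc 0 1)).prod
      ((volume : Measure ℝ).restrict (Set.Icc 0 1))) :=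
    ⟨by rw [volume_restrict_cube_prod]; exact ENNReal.one_lt_top⟩
  exact (hD.comp_fst (((volume : Measure (g.edgeSet → ℝ)).restrict (Set.Icc 0 1)).prod
    ((volume : Measure ℝ).restrict (Set.Icc 0 1)))).comp_snd _

open scoped Classical in
-- The powers of `2` cancel against the halves in the vertex weights. The exponent `3` is the sum of
-- `1/2` for the child weights, `1/2` for the oscillating factor, `1` for the Bessel growth and `1`
-- for absorbing `S ^ (m + 2)` at the cost of `(m + 2)!`.
theorem sum_treeBound_le {T : ℝ} (hT : 0 < T) (ξ : Fin (m + 1) → EuclideanSpace ℝ (Fin ν)) :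
    ∑ g : SimpleGraph (Fin (m + 1)) with g.IsTree, treeBound T g ξ ≤
      T ^ (2 * (m + 1)) * ((m + 2).factorial / 4) * ∏ j, Real.exp (3 * ‖ξ j‖) := by
  set S := ∑ j, ‖ξ j‖ with hS
  have hS0 : 0 ≤ S := Finset.sum_nonneg fun j _ => norm_nonneg _
  have h1 : ∑ g : SimpleGraph (Fin (m + 1)) with g.IsTree, treeBound T g ξ =
      2 ^ m * T ^ (2 * m + 1) * (∑ g : SimpleGraph (Fin (m + 1)) with g.IsTree,
        ∏ p : Fin (m + 1) × Fin (m + 1) with p.1 < p.2 ∧ g.Adj p.1 p.2,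
          (‖ξ p.1‖ / 2) * (‖ξ p.2‖ / 2)) * (T / 4 * S ^ 2) * Real.exp (S / 2) * Real.exp S := by
    simp only [treeBound, ← hS]
    rw [Finset.mul_sum, Finset.sum_mul, Finset.sum_mul, Finset.sum_mul]
  have h2 := sum_trees_prod_edges_le (fun j => ‖ξ j‖ / 2) (fun j => by positivity)
  rw [← Finset.sum_div, ← hS] at h2
  have h3 : ∏ j : Fin m, (‖ξ j.succ‖ / 2) ≤ Real.exp (S / 2) := by
    calc ∏ j : Fin m, (‖ξ j.succ‖ / 2) ≤ ∏ j : Fin m, Real.exp (‖ξ j.succ‖ / 2) :=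
          Finset.prod_le_prod (fun j _ => by positivity)
            fun j _ => (le_add_of_nonneg_right zero_le_one).trans (Real.add_one_le_exp _)
      _ = Real.exp (∑ j : Fin m, ‖ξ j.succ‖ / 2) := (Real.exp_sum _ _).symm
      _ ≤ _ := by
          rw [Real.exp_le_exp, ← Finset.sum_div, hS, Fin.sum_univ_succ]
          linarith [norm_nonneg (ξ 0)]
  have h4 : S ^ (m + 2) ≤ (m + 2).factorial * Real.exp S := by
    have := Real.pow_div_factorial_le_exp S hS0 (m + 2)
    rwa [div_le_iff₀ (by positivity), mul_comm] at this
  have h5 : ∏ j, Real.exp (3 * ‖ξ j‖) = Real.exp (S / 2) * Real.exp (S / 2) * Real.exp S *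
      Real.exp S := by
    rw [← Real.exp_sum, ← Finset.mul_sum, ← hS, ← Real.exp_add, ← Real.exp_add, ← Real.exp_add]
    congr 1
    ring
  rw [h1, h5]
  calc _ ≤ 2 ^ m * T ^ (2 * m + 1) * (Real.exp (S / 2) * (S / 2) ^ m) * (T / 4 * S ^ 2) *
        Real.exp (S / 2) * Real.exp S := by
        gcongr
        exact h2.trans (by gcongr)
    _ = T ^ (2 * (m + 1)) / 4 * (Real.exp (S / 2) * Real.exp (S / 2)) * Real.exp S *
        S ^ (m + 2) := by
        rw [div_pow]
        field_simp
        ring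
    _ ≤ T ^ (2 * (m + 1)) / 4 * (Real.exp (S / 2) * Real.exp (S / 2)) * Real.exp S *
        ((m + 2).factorial * Real.exp S) := by gcongr
    _ = _ := by ring

theorem integrable_treeBound {μ : ComplexMeasure (EuclideanSpace ℝ (Fin ν))}
    [IsFiniteMeasure μ.variation]
    (hμ : Integrable (fun ξ : EuclideanSpace ℝ (Fin ν) => Real.exp (3 * ‖ξ‖)) μ.variation)
    {T : ℝ} (hT : 0 < T) {g : SimpleGraph (Fin (m + 1))} (hg : g.IsTree) :
    Integrable (treeBound T g) (Measure.pi fun _ => μ.variation) := by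
  classical
  have h1 : Integrable (fun ξ : Fin (m + 1) → EuclideanSpace ℝ (Fin ν) =>
      ∏ j, Real.exp (3 * ‖ξ j‖)) (Measure.pi fun _ => μ.variation) :=
    Integrable.fintype_prod (f := fun _ ξ => Real.exp (3 * ‖ξ‖)) fun _ => hμ
  refine (h1.const_mul (T ^ (2 * (m + 1)) * ((m + 2).factorial / 4))).mono'
    (continuous_treeBound T g).aestronglyMeasurable (Filter.Eventually.of_forall fun ξ => ?_)
  rw [Real.norm_of_nonneg (treeBound_nonneg hT g ξ)]
  refine le_trans ?_ (sum_treeBound_le hT ξ)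
  exact Finset.single_le_sum (f := fun g => treeBound T g ξ)
    (fun g _ => treeBound_nonneg hT g ξ) (by simpa using hg)

open scoped Classical in
-- The simplex volume `1 / (m + 1)!` compensates `(m + 2)!` up to a linear factor, which leaves an
-- essentially geometric series.
theorem sum_integral_treeBound_le {μ : ComplexMeasure (EuclideanSpace ℝ (Fin ν))}
    [IsFiniteMeasure μ.variation]
    (hμ : Integrable (fun ξ : EuclideanSpace ℝ (Fin ν) => Real.exp (3 * ‖ξ‖)) μ.variation)
    {T : ℝ} (hT : 0 < T) :
    ∑ g : SimpleGraph (Fin (m + 1)) with g.IsTree, ∫ η, treeBound T g η.2.1 ∂treeMeasure μ g ≤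
      (m + 2) * (T ^ 2 * ∫ ξ, Real.exp (3 * ‖ξ‖) ∂μ.variation) ^ (m + 1) := by
  simp_rw [integral_treeMeasure_comp]
  rw [← Finset.mul_sum, ← integral_finsetSum _ fun g hg =>
    integrable_treeBound hμ hT (Finset.mem_filter.1 hg).2]
  have h1 : Integrable (fun ξ : Fin (m + 1) → EuclideanSpace ℝ (Fin ν) =>
      ∏ j, Real.exp (3 * ‖ξ j‖)) (Measure.pi fun _ => μ.variation) :=
    Integrable.fintype_prod (f := fun _ ξ => Real.exp (3 * ‖ξ‖)) fun _ => hμ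
  have h2 : ∫ ξ : Fin (m + 1) → EuclideanSpace ℝ (Fin ν),
      ∑ g : SimpleGraph (Fin (m + 1)) with g.IsTree, treeBound T g ξ
        ∂(Measure.pi fun _ => μ.variation) ≤ T ^ (2 * (m + 1)) * ((m + 2).factorial / 4) *
      (∫ ξ, Real.exp (3 * ‖ξ‖) ∂μ.variation) ^ (m + 1) := by
    refine (integral_mono (integrable_finsetSum _ fun g hg =>
      integrable_treeBound hμ hT (Finset.mem_filter.1 hg).2)
      (h1.const_mul _) fun ξ => sum_treeBound_le hT ξ).trans_eq ?_
    rw [integral_const_mul, integral_fintype_prod_eq_pow (fun ξ => Real.exp (3 * ‖ξ‖)),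
      Fintype.card_fin]
  have h3 : volume.real (orderedSimplex (m + 1)) ≤ 1 / (m + 1).factorial :=
    ENNReal.toReal_le_of_le_ofReal (by positivity) (volume_orderedSimplex_le (m + 1))
  have h4 : 0 ≤ ∫ ξ, Real.exp (3 * ‖ξ‖) ∂μ.variation := integral_nonneg fun _ => (Real.exp_pos _).le
  calc _ ≤ 1 / ((m + 1).factorial : ℝ) * (T ^ (2 * (m + 1)) * ((m + 2).factorial / 4) *
      (∫ ξ, Real.exp (3 * ‖ξ‖) ∂μ.variation) ^ (m + 1)) := by
        refine mul_le_mul h3 h2 (integral_nonneg fun ξ => Finset.sum_nonneg fun g _ =>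
          treeBound_nonneg hT g ξ) (by positivity)
    _ = (m + 2) / 4 * (T ^ 2 * ∫ ξ, Real.exp (3 * ‖ξ‖) ∂μ.variation) ^ (m + 1) := by
        rw [Nat.factorial_succ (m + 1), mul_pow, ← pow_mul]
        have : ((m + 1).factorial : ℝ) ≠ 0 := by positivity
        push_cast
        field_simp
        ring
    _ ≤ _ := by
        have : 0 ≤ (T ^ 2 * ∫ ξ, Real.exp (3 * ‖ξ‖) ∂μ.variation) ^ (m + 1) := by positivity
        have hm : (0 : ℝ) ≤ m := m.cast_nonneg
        gcongr
        linarith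

theorem norm_exp_neg_mul_le {h : ℂ} (hh : 0 < h.re) (a : NNReal) :
    ‖Complex.exp (-h * (a : ℝ))‖ ≤ 1 := by
  rw [Complex.norm_exp, Complex.re_mul_ofReal, Complex.neg_re, Real.exp_le_one_iff]
  exact mul_nonpos_of_nonpos_of_nonneg (by linarith) a.coe_nonneg

/-- The contribution of the tree `g` to `wTerm`. -/
def treeTerm (ω : Fin ν → ℝ) (μ : ComplexMeasure (EuclideanSpace ℝ (Fin ν)))
    (g : SimpleGraph (Fin (m + 1))) (t : ℝ)
    (v : EuclideanSpace ℂ (Fin ν) × EuclideanSpace ℂ (Fin ν)) (h : ℂ) : ℂ :=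
  ∫ η, treeAmplitude ω μ g t v η * Complex.exp (-h * (treePhase ω g t η : ℝ)) ∂treeMeasure μ g

theorem ae_norm_treeAmplitude_le {ω : Fin ν → ℝ} (hω : ∀ υ, 0 < ω υ)
    (μ : ComplexMeasure (EuclideanSpace ℝ (Fin ν))) [IsFiniteMeasure μ.variation] (T : ℝ)
    {g : SimpleGraph (Fin (m + 1))} (hg : g.IsTree) :
    ∀ᵐ η ∂treeMeasure μ g, ∀ t ∈ Set.Ioo 0 T, ∀ v ∈ tube ν (1 / 2) ×ˢ tube ν (1 / 2),
      ‖treeAmplitude ω μ g t v η‖ *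
        Real.exp (2 * Real.sqrt (1 / T) * Real.sqrt (treePhase ω g t η)) ≤ treeBound T g η.2.1 := by
  filter_upwards [ae_treeMeasure μ g] with η hη t ht v hv
  exact norm_treeAmplitude_le hω ht hg hv hη.1 hη.2.1 hη.2.2.1 hη.2.2.2

theorem ae_norm_treeIntegrand_le {ω : Fin ν → ℝ} (hω : ∀ υ, 0 < ω υ)
    (μ : ComplexMeasure (EuclideanSpace ℝ (Fin ν))) [IsFiniteMeasure μ.variation] {T t : ℝ}
    (ht : t ∈ Set.Ioo 0 T) {g : SimpleGraph (Fin (m + 1))} (hg : g.IsTree)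
    {v : EuclideanSpace ℂ (Fin ν) × EuclideanSpace ℂ (Fin ν)}
    (hv : v ∈ tube ν (1 / 2) ×ˢ tube ν (1 / 2)) {h : ℂ} (hh : 0 < h.re) :
    ∀ᵐ η ∂treeMeasure μ g,
      ‖treeAmplitude ω μ g t v η * Complex.exp (-h * (treePhase ω g t η : ℝ))‖ ≤
        treeBound T g η.2.1 := by
  filter_upwards [ae_norm_treeAmplitude_le hω μ T hg] with η hη
  refine le_trans ?_ (hη t ht v hv)
  rw [norm_mul]
  gcongr
  exact (norm_exp_neg_mul_le hh _).trans (Real.one_le_exp (by positivity))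

theorem integrable_treeIntegrand {ω : Fin ν → ℝ} (hω : ∀ υ, 0 < ω υ)
    {μ : ComplexMeasure (EuclideanSpace ℝ (Fin ν))} [IsFiniteMeasure μ.variation]
    (hμ : Integrable (fun ξ : EuclideanSpace ℝ (Fin ν) => Real.exp (3 * ‖ξ‖)) μ.variation)
    {T t : ℝ} (ht : t ∈ Set.Ioo 0 T) {g : SimpleGraph (Fin (m + 1))} (hg : g.IsTree)
    {v : EuclideanSpace ℂ (Fin ν) × EuclideanSpace ℂ (Fin ν)}
    (hv : v ∈ tube ν (1 / 2) ×ˢ tube ν (1 / 2)) {h : ℂ} (hh : 0 < h.re) :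
    Integrable (fun η => treeAmplitude ω μ g t v η *
      Complex.exp (-h * (treePhase ω g t η : ℝ))) (treeMeasure μ g) := by
  refine (integrable_treeMeasure_comp μ g
    (integrable_treeBound hμ (ht.1.trans ht.2) hg)).mono' ?_
    (ae_norm_treeIntegrand_le hω μ ht hg hv hh)
  refine ((measurable_treeAmplitude ω μ hg t v).mul ?_).aestronglyMeasurable
  have := measurable_treePhase ω t hg
  fun_prop

theorem norm_treeTerm_le {ω : Fin ν → ℝ} (hω : ∀ υ, 0 < ω υ)
    {μ : ComplexMeasure (EuclideanSpace ℝ (Fin ν))} [IsFiniteMeasure μ.variation]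
    (hμ : Integrable (fun ξ : EuclideanSpace ℝ (Fin ν) => Real.exp (3 * ‖ξ‖)) μ.variation)
    {T t : ℝ} (ht : t ∈ Set.Ioo 0 T) {g : SimpleGraph (Fin (m + 1))} (hg : g.IsTree)
    {v : EuclideanSpace ℂ (Fin ν) × EuclideanSpace ℂ (Fin ν)}
    (hv : v ∈ tube ν (1 / 2) ×ˢ tube ν (1 / 2)) {h : ℂ} (hh : 0 < h.re) :
    ‖treeTerm ω μ g t v h‖ ≤ ∫ η, treeBound T g η.2.1 ∂treeMeasure μ g :=
  norm_integral_le_of_norm_le (integrable_treeMeasure_comp μ g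
    (integrable_treeBound hμ (ht.1.trans ht.2) hg)) (ae_norm_treeIntegrand_le hω μ ht hg hv hh)

open scoped Classical in
-- Fubini on the product space, justified by `treeBound`. On the domain of integration `Ω ≥ 0`, so
-- the truncation in `treePhase` changes nothing.
theorem wTerm_eq_sum_treeTerm {ω : Fin ν → ℝ} (hω : ∀ υ, 0 < ω υ)
    {μ : ComplexMeasure (EuclideanSpace ℝ (Fin ν))} [IsFiniteMeasure μ.variation]
    (hμ : Integrable (fun ξ : EuclideanSpace ℝ (Fin ν) => Real.exp (3 * ‖ξ‖)) μ.variation)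
    {T t : ℝ} (ht : t ∈ Set.Ioo 0 T)
    {v : EuclideanSpace ℂ (Fin ν) × EuclideanSpace ℂ (Fin ν)}
    (hv : v ∈ tube ν (1 / 2) ×ˢ tube ν (1 / 2)) {h : ℂ} (hh : 0 < h.re) :
    wTerm ω μ (m + 1) t v.1 v.2 h =
      ∑ g : SimpleGraph (Fin (m + 1)) with g.IsTree, treeTerm ω μ g t v h := by
  rw [wTerm, Finset.mul_sum]
  refine Finset.sum_congr rfl fun g hg => ?_
  replace hg : g.IsTree := (Finset.mem_filter.1 hg).2
  rw [treeTerm]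
  refine Eq.trans ?_ (integral_prod_four (integrable_treeIntegrand hω hμ ht hg hv hh)).symm
  rw [← integral_const_mul]
  refine setIntegral_congr_fun (measurableSet_orderedSimplex _) fun s hs => ?_
  simp only [integralPow]
  rw [← integral_const_mul]
  refine integral_congr_ae (Filter.Eventually.of_forall fun ξ => ?_)
  beta_reduce
  rw [← integral_mul_const, ← integral_const_mul]
  refine setIntegral_congr_fun measurableSet_Icc fun θ hθ => ?_
  rw [← integral_mul_const, ← integral_const_mul]
  refine setIntegral_congr_fun measurableSet_Icc fun u hu => ?_
  rw [treePhase_eq hω ht.1 hg (η := (s, ξ, θ, u)) hs hθ hu, treeAmplitude]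
  simp only [Nat.add_sub_cancel, show 2 * (m + 1) - 1 = 2 * m + 1 by omega]
  push_cast
  rw [show -h * (u * (omegaForm ω t g θ s ξ : ℂ)) = -h * u * omegaForm ω t g θ s ξ by ring]
  ring

end TreeSum

/-! ### The Borel transform of `exp w` -/

section Exponential

namespace BorelFamily

variable {V : Type*} [NormedAddCommGroup V] [NormedSpace ℂ V] {I : Set ℝ} {U : Set V} {S : Set ℂ}
  {r C : ℝ} {f : ℝ → V → ℂ → ℂ} {φ : ℝ → NNReal → V → ℂ → ℂ}

theorem const_mul (hφ : BorelFamily I U S r C f φ) {k : ℝ} (hk : 0 ≤ k) :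
    BorelFamily I U S r (k * C) (fun t v h => k * f t v h) (fun t a v σ => k * φ t a v σ) := by
  refine ⟨continuousOn_const.mul hφ.continuousOn, fun t ht a z hz w => ?_,
    fun t ht a v hv σ hσ => ?_, fun t ht a v hv h hh => ?_⟩
  · exact DifferentiableAt.const_mul (hφ.line t ht a z hz w) _
  · rw [norm_mul, Complex.norm_real, Real.norm_of_nonneg hk, mul_assoc]
    exact mul_le_mul_of_nonneg_left (hφ.bound t ht a v hv σ hσ) hk
  · rw [mul_assoc, ← hφ.laplace t ht a v hv h hh, ← integral_const_mul]
    congr 1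
    ext σ
    ring

/-- The exponential series of a family on which multiplication acts boundedly. -/
theorem exists_exp (hU : IsOpen U) (hSo : IsOpen S) (hS : ∀ σ : ℝ, 0 < σ → (σ : ℂ) ∈ S) {β : ℝ}
    (hβ : 0 ≤ β) {w : ℝ → V → ℂ → ℂ} (hbase : BorelFamily I U S r 1 (fun _ _ _ => 1) φ)
    (hstep : ∀ C f φ, 0 ≤ C → BorelFamily I U S r C f φ →
      ∃ φ', BorelFamily I U S r (C * β) (fun t v h => f t v h * w t v h) φ') :
    ∃ φ', BorelFamily I U S r (Real.exp β) (fun t v h => Complex.exp (w t v h)) φ' := by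
  -- Each multiplication by `w` costs a factor `β`, so the terms of the exponential series have
  -- constants `β ^ n / n!`.
  have hpow : ∀ n : ℕ, ∃ φ', BorelFamily I U S r (β ^ n) (fun t v h => w t v h ^ n) φ' := by
    intro n
    induction n with
    | zero => exact ⟨φ, by simpa using hbase⟩
    | succ n ih =>
      obtain ⟨φ₁, h₁⟩ := ih
      obtain ⟨φ₂, h₂⟩ := hstep _ _ _ (pow_nonneg hβ n) h₁
      exact ⟨φ₂, by simpa only [pow_succ] using h₂⟩
  choose Φ hΦ using hpow
  have h1 := fun n : ℕ => (hΦ n).const_mul (k := ((n.factorial : ℝ))⁻¹) (by positivity)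
  have hs := NormedSpace.expSeries_div_hasSum_exp (𝔸 := ℝ) β
  rw [← Real.exp_eq_exp_ℝ] at hs
  have hs' : HasSum (fun n : ℕ => ((n.factorial : ℝ))⁻¹ * β ^ n) (Real.exp β) := by
    simpa only [div_eq_inv_mul] using hs
  have h2 := BorelFamily.tsum hU hSo hS hs'.summable h1
  rw [hs'.tsum_eq] at h2
  refine ⟨_, h2.congr fun t _ v _ h _ => ?_⟩
  have h3 := NormedSpace.expSeries_div_hasSum_exp (𝔸 := ℂ) (w t v h)
  rw [← Complex.exp_eq_exp_ℂ] at h3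
  rw [← h3.tsum_eq]
  refine tsum_congr fun n => ?_
  push_cast
  ring

end BorelFamily

variable {ν : ℕ}

/-- The bound for `wTerm ω μ (m + 1)`. -/
def wBound (μ : ComplexMeasure (EuclideanSpace ℝ (Fin ν))) (T : ℝ) (m : ℕ) : ℝ :=
  (m + 2) * (T ^ 2 * ∫ ξ, Real.exp (3 * ‖ξ‖) ∂μ.variation) ^ (m + 1)

theorem wBound_nonneg (μ : ComplexMeasure (EuclideanSpace ℝ (Fin ν))) (T : ℝ) (m : ℕ) :
    0 ≤ wBound μ T m := by
  have h4 : 0 ≤ ∫ ξ, Real.exp (3 * ‖ξ‖) ∂μ.variation := integral_nonneg fun _ => (Real.exp_pos _).le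
  unfold wBound
  positivity

theorem summable_nat_add_two_mul_pow {q : ℝ} (h0 : 0 ≤ q) (h1 : q < 1) :
    Summable fun m : ℕ => ((m : ℝ) + 2) * q ^ (m + 1) := by
  have hn : ‖q‖ < 1 := by rwa [Real.norm_of_nonneg h0]
  have h2 : Summable fun m : ℕ => (m : ℝ) ^ 1 * q ^ m := summable_pow_mul_geometric_of_norm_lt_one 1 hn
  have h3 : Summable fun m : ℕ => q ^ m := summable_geometric_of_norm_lt_one hn
  refine ((h2.add (h3.mul_left 2)).mul_left q).congr fun m => ?_
  ring

theorem summable_wBound {μ : ComplexMeasure (EuclideanSpace ℝ (Fin ν))} {T : ℝ}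
    (h : T ^ 2 * ∫ ξ, Real.exp (3 * ‖ξ‖) ∂μ.variation < 1) : Summable (wBound μ T) :=
  summable_nat_add_two_mul_pow
    (mul_nonneg (sq_nonneg T) (integral_nonneg fun _ => (Real.exp_pos _).le)) h

section

variable {ω : Fin ν → ℝ} {μ : ComplexMeasure (EuclideanSpace ℝ (Fin ν))}
  [IsFiniteMeasure μ.variation] {T : ℝ}

theorem norm_wTerm_le (hω : ∀ υ, 0 < ω υ)
    (hμ : Integrable (fun ξ : EuclideanSpace ℝ (Fin ν) => Real.exp (3 * ‖ξ‖)) μ.variation)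
    {t : ℝ} (ht : t ∈ Set.Ioo 0 T) {v : EuclideanSpace ℂ (Fin ν) × EuclideanSpace ℂ (Fin ν)}
    (hv : v ∈ tube ν (1 / 2) ×ˢ tube ν (1 / 2)) {h : ℂ} (hh : 0 < h.re) (m : ℕ) :
    ‖wTerm ω μ (m + 1) t v.1 v.2 h‖ ≤ wBound μ T m := by
  classical
  rw [wTerm_eq_sum_treeTerm hω hμ ht hv hh]
  refine (norm_sum_le_of_le _ fun g hg =>
    norm_treeTerm_le hω hμ ht (Finset.mem_filter.1 hg).2 hv hh).trans ?_
  refine le_trans (le_of_eq ?_) (sum_integral_treeBound_le hμ (ht.1.trans ht.2))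
  congr!

theorem exists_borelFamily_mul_treeTerm (hω : ∀ υ, 0 < ω υ)
    (hμ : Integrable (fun ξ : EuclideanSpace ℝ (Fin ν) => Real.exp (3 * ‖ξ‖)) μ.variation)
    (hT : 0 < T) {m : ℕ} {g : SimpleGraph (Fin (m + 1))} (hg : g.IsTree) {C : ℝ} (hC : 0 ≤ C)
    {f φ} (hφ : BorelFamily (Set.Ioo 0 T) (tube ν (1 / 2) ×ˢ tube ν (1 / 2)) (parabola (1 / T))
      (2 * Real.sqrt (1 / T)) C f φ) :
    ∃ φ', BorelFamily (Set.Ioo 0 T) (tube ν (1 / 2) ×ˢ tube ν (1 / 2)) (parabola (1 / T))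
      (2 * Real.sqrt (1 / T)) (C * ∫ η, treeBound T g η.2.1 ∂treeMeasure μ g)
      (fun t v h => f t v h * treeTerm ω μ g t v h) φ' :=
  ⟨_, BorelFamily.integral ((isOpen_tube ν _).prod (isOpen_tube ν _)) (isOpen_parabola _)
    (fun _ => ofReal_mem_parabola (one_div_pos.2 hT)) (by positivity) hC hφ
    (integrable_treeMeasure_comp μ g (integrable_treeBound hμ hT hg))
    (fun t _ v _ => (measurable_treeAmplitude ω μ hg t v).aestronglyMeasurable)
    (fun t _ => measurable_treePhase ω t hg) (ae_norm_treeAmplitude_le hω μ T hg)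
    (fun η => (continuousOn_treeAmplitude hω μ g η).mono fun p hp => ⟨hp.1.1, trivial⟩)
    (fun η => (continuousOn_treePhase hω g η).mono fun t ht => ht.1)
    (fun η t _ v _ w => ((differentiable_treeAmplitude ω μ g t η) v).lineDifferentiableAt)⟩

theorem exists_borelFamily_mul_wTerm (hω : ∀ υ, 0 < ω υ)
    (hμ : Integrable (fun ξ : EuclideanSpace ℝ (Fin ν) => Real.exp (3 * ‖ξ‖)) μ.variation)
    (hT : 0 < T) (m : ℕ) {C : ℝ} (hC : 0 ≤ C)
    {f φ} (hφ : BorelFamily (Set.Ioo 0 T) (tube ν (1 / 2) ×ˢ tube ν (1 / 2)) (parabola (1 / T))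
      (2 * Real.sqrt (1 / T)) C f φ) :
    ∃ φ', BorelFamily (Set.Ioo 0 T) (tube ν (1 / 2) ×ˢ tube ν (1 / 2)) (parabola (1 / T))
      (2 * Real.sqrt (1 / T)) (C * wBound μ T m)
      (fun t v h => f t v h * wTerm ω μ (m + 1) t v.1 v.2 h) φ' := by
  classical
  choose Φ hΦ using fun g : {g : SimpleGraph (Fin (m + 1)) // g.IsTree} =>
    exists_borelFamily_mul_treeTerm hω hμ hT g.2 hC hφ
  have h1 := BorelFamily.tsum ((isOpen_tube ν _).prod (isOpen_tube ν _)) (isOpen_parabola _)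
    (fun _ => ofReal_mem_parabola (one_div_pos.2 hT)) (Summable.of_finite) hΦ
  refine ⟨_, (h1.mono ?_).congr ?_⟩
  · rw [tsum_mul_left, tsum_fintype]
    refine mul_le_mul_of_nonneg_left (le_trans (le_of_eq ?_)
      (sum_integral_treeBound_le (m := m) hμ hT)) hC
    rw [Finset.sum_subtype (p := SimpleGraph.IsTree) _ (by simp)]
  · intro t ht v hv h hh
    rw [tsum_mul_left, tsum_fintype, wTerm_eq_sum_treeTerm hω hμ ht hv hh]
    congr 1
    rw [Finset.sum_subtype (p := SimpleGraph.IsTree) _ (by simp)]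

theorem summable_wTerm (hω : ∀ υ, 0 < ω υ)
    (hμ : Integrable (fun ξ : EuclideanSpace ℝ (Fin ν) => Real.exp (3 * ‖ξ‖)) μ.variation)
    (hT1 : T ^ 2 * ∫ ξ, Real.exp (3 * ‖ξ‖) ∂μ.variation < 1)
    {t : ℝ} (ht : t ∈ Set.Ioo 0 T) {v : EuclideanSpace ℂ (Fin ν) × EuclideanSpace ℂ (Fin ν)}
    (hv : v ∈ tube ν (1 / 2) ×ˢ tube ν (1 / 2)) {h : ℂ} (hh : 0 < h.re) :
    Summable fun m : ℕ => wTerm ω μ (m + 1) t v.1 v.2 h :=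
  Summable.of_norm_bounded (summable_wBound hT1) (norm_wTerm_le hω hμ ht hv hh)

theorem exists_borelFamily_mul_wSeries (hω : ∀ υ, 0 < ω υ)
    (hμ : Integrable (fun ξ : EuclideanSpace ℝ (Fin ν) => Real.exp (3 * ‖ξ‖)) μ.variation)
    (hT : 0 < T) (hT1 : T ^ 2 * ∫ ξ, Real.exp (3 * ‖ξ‖) ∂μ.variation < 1) {C : ℝ} (hC : 0 ≤ C)
    {f φ} (hφ : BorelFamily (Set.Ioo 0 T) (tube ν (1 / 2) ×ˢ tube ν (1 / 2)) (parabola (1 / T))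
      (2 * Real.sqrt (1 / T)) C f φ) :
    ∃ φ', BorelFamily (Set.Ioo 0 T) (tube ν (1 / 2) ×ˢ tube ν (1 / 2)) (parabola (1 / T))
      (2 * Real.sqrt (1 / T)) (C * ∑' m, wBound μ T m)
      (fun t v h => f t v h * wSeries ω μ t v.1 v.2 h) φ' := by
  choose Φ hΦ using fun m => exists_borelFamily_mul_wTerm hω hμ hT m hC hφ
  have h1 := BorelFamily.tsum ((isOpen_tube ν _).prod (isOpen_tube ν _)) (isOpen_parabola _)
    (fun _ => ofReal_mem_parabola (one_div_pos.2 hT)) ((summable_wBound hT1).mul_left C) hΦ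
  refine ⟨_, (h1.mono tsum_mul_left.le).congr fun t _ v _ h _ => ?_⟩
  rw [tsum_mul_left, wSeries]

theorem exists_borelFamily_exp_wSeries (hω : ∀ υ, 0 < ω υ)
    (hμ : Integrable (fun ξ : EuclideanSpace ℝ (Fin ν) => Real.exp (3 * ‖ξ‖)) μ.variation)
    (hT : 0 < T) (hT1 : T ^ 2 * ∫ ξ, Real.exp (3 * ‖ξ‖) ∂μ.variation < 1) :
    ∃ C φ, 0 < C ∧ BorelFamily (Set.Ioo 0 T) (tube ν (1 / 2) ×ˢ tube ν (1 / 2)) (parabola (1 / T))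
      (2 * Real.sqrt (1 / T)) C (fun t v h => Complex.exp (wSeries ω μ t v.1 v.2 h)) φ := by
  obtain ⟨φ, hφ⟩ := BorelFamily.exists_exp ((isOpen_tube ν _).prod (isOpen_tube ν _))
    (isOpen_parabola _) (fun _ => ofReal_mem_parabola (one_div_pos.2 hT))
    (tsum_nonneg (wBound_nonneg μ T)) (borelFamily_bess _ _ _)
    fun C f φ hC hφ => exists_borelFamily_mul_wSeries hω hμ hT hT1 hC hφ
  exact ⟨_, φ, Real.exp_pos _, hφ⟩

end

/-- A jointly continuous family of functions, holomorphic along complex lines, is a continuous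
family of analytic functions. -/
theorem isContinuousAnalyticFamily_of_continuousOn {E : Type*} [NormedAddCommGroup E]
    [NormedSpace ℂ E] [FiniteDimensional ℂ E] {T : ℝ} {Ω : Set E} (hΩ : IsOpen Ω)
    {F : ℝ → E → ℂ} (hF : ContinuousOn (fun p : ℝ × E => F p.1 p.2) (Set.Ioo 0 T ×ˢ Ω))
    (hl : ∀ t ∈ Set.Ioo 0 T, ∀ z ∈ Ω, ∀ w, LineDifferentiableAt ℂ (F t) z w) :
    IsContinuousAnalyticFamily (Set.Ioo 0 T) Ω F := by
  refine ⟨fun t ht => analyticOnNhd_of_lineDifferentiableAt hΩ ?_ (hl t ht), ?_⟩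
  · exact hF.comp (f := fun z => (t, z)) (by fun_prop) fun z hz => ⟨ht, hz⟩
  · intro t₀ ht₀ K hK hKc
    obtain ⟨δ, hδ, hball⟩ := Metric.nhds_basis_closedBall.mem_iff.1
      (isOpen_Ioo.mem_nhds ht₀ : Set.Ioo 0 T ∈ nhds t₀)
    -- Joint continuity on a compact neighbourhood of `t₀` times `K` is uniform, which gives uniform
    -- convergence on `K`.
    have hu : UniformContinuousOn (fun p : ℝ × E => F p.1 p.2) (Metric.closedBall t₀ δ ×ˢ K) :=
      ((isCompact_closedBall t₀ δ).prod hKc).uniformContinuousOn_of_continuous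
        (hF.mono (Set.prod_mono hball hK))
    have h1 := UniformContinuousOn.tendstoUniformlyOn (F := F) hu (Metric.mem_closedBall_self hδ.le)
    rw [nhdsWithin_eq_nhds.2 (Metric.closedBall_mem_nhds t₀ hδ)] at h1
    exact fun u hu => nhdsWithin_le_nhds (h1 u hu)

/-- Only a weaker consequence of the smallness assumption is kept, from `3|ξ| ≤ ε|ξ|² + 5|ξ|` and
`T² ≤ 4 T² exp T`. -/
theorem isFiniteMeasure_and_integrable_of_expMoment
    {μ : ComplexMeasure (EuclideanSpace ℝ (Fin ν))} {ε T : ℝ} (hε : 0 < ε) (hT : 0 < T)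
    (hμ : ENNReal.ofReal (4 * T ^ 2 * Real.exp T) * expMoment μ ε < 1) :
    IsFiniteMeasure μ.variation ∧
      Integrable (fun ξ : EuclideanSpace ℝ (Fin ν) => Real.exp (3 * ‖ξ‖)) μ.variation ∧
      T ^ 2 * ∫ ξ, Real.exp (3 * ‖ξ‖) ∂μ.variation < 1 := by
  have hpos : 0 < 4 * T ^ 2 * Real.exp T := by positivity
  have hfin : expMoment μ ε ≠ ⊤ := by
    intro h
    rw [h, ENNReal.mul_top (ENNReal.ofReal_pos.2 hpos).ne'] at hμ
    exact absurd hμ (by simp)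
  have hle : ∫⁻ ξ, ENNReal.ofReal (Real.exp (3 * ‖ξ‖)) ∂μ.variation ≤ expMoment μ ε := by
    refine lintegral_mono fun ξ => ENNReal.ofReal_le_ofReal (Real.exp_le_exp.2 ?_)
    have := norm_nonneg ξ
    nlinarith [mul_nonneg hε.le (sq_nonneg ‖ξ‖)]
  have hint : Integrable (fun ξ : EuclideanSpace ℝ (Fin ν) => Real.exp (3 * ‖ξ‖)) μ.variation := by
    refine ⟨Continuous.aestronglyMeasurable (by fun_prop), ?_⟩
    rw [hasFiniteIntegral_iff_ofReal (Filter.Eventually.of_forall fun _ => (Real.exp_pos _).le)]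
    exact hle.trans_lt hfin.lt_top
  refine ⟨⟨?_⟩, hint, ?_⟩
  · refine lt_of_le_of_lt ?_ (hle.trans_lt hfin.lt_top)
    rw [← lintegral_one]
    refine lintegral_mono fun ξ => ?_
    rw [← ENNReal.ofReal_one]
    exact ENNReal.ofReal_le_ofReal (Real.one_le_exp (by positivity))
  · have h4 : 0 ≤ ∫ ξ, Real.exp (3 * ‖ξ‖) ∂μ.variation :=
      integral_nonneg fun _ => (Real.exp_pos _).le
    rw [← ofReal_integral_eq_lintegral_ofReal hint
      (Filter.Eventually.of_forall fun _ => (Real.exp_pos _).le)] at hle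
    have h5 : ENNReal.ofReal (4 * T ^ 2 * Real.exp T * ∫ ξ, Real.exp (3 * ‖ξ‖) ∂μ.variation) < 1 := by
      rw [ENNReal.ofReal_mul hpos.le]
      exact (mul_le_mul_right hle _).trans_lt hμ
    rw [ENNReal.ofReal_lt_one] at h5
    have h6 : T ^ 2 ≤ 4 * T ^ 2 * Real.exp T := by
      nlinarith [Real.one_le_exp hT.le, sq_nonneg T]
    exact (mul_le_mul_of_nonneg_right h6 h4).trans_lt h5

end Exponential

end TreeHeat

end

/-! ### The proposition, read off at shift zero -/

theorem mainTheorem5 (ν : ℕ) (ω : Fin ν → ℝ) (hω : ∀ υ, 0 < ω υ)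
    (T ε : ℝ) (hT : 0 < T) (hε : 0 < ε)
    (μ : MeasureTheory.ComplexMeasure (EuclideanSpace ℝ (Fin ν)))
    (hμ : ENNReal.ofReal (4 * T ^ 2 * Real.exp T) * TreeHeat.expMoment μ ε < 1) :
    ∃ κ K K₁ : ℝ, 0 < κ ∧ 0 < K ∧ 0 < K₁ ∧
      ∃ W : ℝ → EuclideanSpace ℂ (Fin ν) × EuclideanSpace ℂ (Fin ν) × ℂ → ℂ,
        TreeHeat.IsContinuousAnalyticFamily (Set.Ioo 0 T)
          (TreeHeat.tube ν (1 / 2) ×ˢ TreeHeat.tube ν (1 / 2) ×ˢ TreeHeat.parabola κ) W ∧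
        ∀ t ∈ Set.Ioo 0 T, ∀ x ∈ TreeHeat.tube ν (1 / 2), ∀ y ∈ TreeHeat.tube ν (1 / 2),
          (∀ σ ∈ TreeHeat.parabola κ,
            ‖W t (x, y, σ)‖ ≤ K₁ * Real.exp (K * ‖σ‖ ^ (1 / 2 : ℝ))) ∧
          ∀ h : ℂ, 0 < h.re →
            Summable (fun m : ℕ => TreeHeat.wTerm ω μ (m + 1) t x y h) ∧
            MeasureTheory.IntegrableOn
              (fun σ : ℝ => Complex.exp (-σ / h) * W t (x, y, (σ : ℂ)) / h) (Set.Ioi 0) ∧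
            Complex.exp (TreeHeat.wSeries ω μ t x y h) =
              ∫ σ in Set.Ioi (0 : ℝ), Complex.exp (-σ / h) * W t (x, y, (σ : ℂ)) / h := by
  obtain ⟨hfin, hint, hT1⟩ := TreeHeat.isFiniteMeasure_and_integrable_of_expMoment hε hT hμ
  obtain ⟨C, φ, hC, hφ⟩ := TreeHeat.exists_borelFamily_exp_wSeries hω hint hT hT1
  -- At `a = 0` the weight `exp (r √a)` is `1`, so the function is bounded by `C` on the whole
  -- domain; the exponential rate `K = 1` is an arbitrary positive choice.
  refine ⟨1 / T, 1, C, by positivity, one_pos, hC, fun t z => φ t 0 (z.1, z.2.1) z.2.2, ?_, ?_⟩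
  · refine TreeHeat.isContinuousAnalyticFamily_of_continuousOn
      ((TreeHeat.isOpen_tube ν _).prod
        ((TreeHeat.isOpen_tube ν _).prod (TreeHeat.isOpen_parabola _))) ?_ ?_
    · exact hφ.continuousOn.comp
        (f := fun p : ℝ × EuclideanSpace ℂ (Fin ν) × EuclideanSpace ℂ (Fin ν) × ℂ =>
          (p.1, (0 : NNReal), (p.2.1, p.2.2.1), p.2.2.2)) (by fun_prop)
        fun p hp => ⟨hp.1, trivial, ⟨hp.2.1, hp.2.2.1⟩, hp.2.2.2⟩
    · exact fun t ht z hz w => hφ.line t ht 0 ((z.1, z.2.1), z.2.2) ⟨⟨hz.1, hz.2.1⟩, hz.2.2⟩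
        ((w.1, w.2.1), w.2.2)
  · intro t ht x hx y hy
    have hv : (x, y) ∈ TreeHeat.tube ν (1 / 2) ×ˢ TreeHeat.tube ν (1 / 2) := ⟨hx, hy⟩
    refine ⟨fun σ hσ => ?_, fun h hh => ⟨?_, ?_, ?_⟩⟩
    · refine (hφ.bound t ht 0 (x, y) hv σ hσ).trans
        (mul_le_mul_of_nonneg_left (Real.exp_le_exp.2 ?_) hC.le)
      rw [NNReal.coe_zero, Real.sqrt_zero, mul_zero]
      positivity
    · exact TreeHeat.summable_wTerm hω hint hT1 ht hv hh
    · exact hφ.integrableOn (fun _ => TreeHeat.ofReal_mem_parabola (one_div_pos.2 hT)) ht 0 hv hh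
    · have := hφ.laplace t ht 0 (x, y) hv h hh
      rw [NNReal.coe_zero, Complex.ofReal_zero, mul_zero, Complex.exp_zero, mul_one] at this
      exact this.symm
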